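/- Let $(\Omega,\mathcal A,\mathbf P)$ be a probability space, $T:\Omega\to\Omega$ a bijective bimeasurable transformation preserving $\mathbf P$, and $\mathcal F_0\subseteq\mathcal A$ a $\sigma$-algebra with $\mathcal F_0\subseteq T^{-1}(\mathcal F_0)$. Put $\mathcal F_i=T^{-i}(\mathcal F_0)$ for $i\in\mathbf Z$, $\mathcal F_{-\infty}=\bigcap_{n\ge 0}\mathcal F_{-n}$, $\mathcal F_\infty=\bigvee_{k\in\mathbf Z}\mathcal F_k$, and $P_j(Z)=\mathbf E(Z|\mathcal F_j)-\mathbf E(Z|\mathcal F_{j-1})$. Let $\alpha>0$ and let $\Psi:[0,\infty)\to[0,\infty)$ be a convex, continuous, nondecreasing function, not identically zero, with $\Psi(0)=0$, with $\Psi(cx)\le c^\alpha\Psi(x)$ for all $c\ge 2$, $x\ge 0$, and such that $x\mapsto\Psi(\sqrt x)$ is convex. Let $\mathbf L_\Psi$ be the space of random variables $X$ with $\mathbf E\Psi(|X|/c)<\infty$ for some $c>0$, with the norm $\|X\|_\Psi=\inf\{c>0:\mathbf E\Psi(|X|/c)\le 1\}$. Let $\xi_0\in\mathbf L_\Psi$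 be a real random variable that is $\mathcal F_\infty$-measurable and satisfies $\mathbf E(\xi_0|\mathcal F_{-\infty})=0$ almost surely; put $\xi_i=\xi_0\circ T^i$ and assume $\sum_{j\in\mathbf Z}\|P_0(\xi_j)\|_\Psi<\infty$. Let $(a_i)_{i\in\mathbf Z}$ be a sequence of real numbers in $\ell^2$. Then the series $$d_j=\sum_{\ell\in\mathbf Z}P_j(\xi_\ell),\qquad X_k=\sum_{j\in\mathbf Z}a_j\xi_{k-j},\qquad Y_k=\sum_{j\in\mathbf Z}a_jd_{k-j}\qquad(j,k\in\mathbf Z)$$ converge in $\mathbf L^2$. Put $S_n=\sum_{k=1}^nX_k$, $T_n=\sum_{k=1}^nY_k$, $c_{n,j}=a_{1-j}+\dots+a_{n-j}$ and $v_n=\bigl(\sum_{j\in\mathbf Z}c_{n,j}^2\bigr)^{1/2}$. There exist positive constants $C_1$ and $C_2$, depending neither on $n$ nor on $m$, such that for every $n$ and every real $m>0$ $$\|S_n-T_n\|_\Psi\le C_1v_n^2\sum_{|k|\ge m}\|P_0(\xi_k)\|_\Psi+C_2m$$ and also $$\|S_n-T_n\|_\Psi\le C_1v_n\sum_{|k|\ge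 m}\|P_0(\xi_k)\|_\Psi+C_2m .$$ -/

import Mathlib

open MeasureTheory Filter Topology

noncomputable section

/-- The class `A_α`: functions `Φ : [0, ∞) → [0, ∞)` with `Φ 0 = 0`, nondecreasing, continuous, and
`Φ (c x) ≤ c ^ α Φ x` for all `c ≥ 2`, `x ≥ 0`.  Such a function is represented by a function on `ℝ`
of which only the restriction to `[0, ∞)` is ever used. -/
structure ClassA (α : ℝ) (Φ : ℝ → ℝ) : Prop where
  nonneg : ∀ x, 0 ≤ x → 0 ≤ Φ x
  map_zero : Φ 0 = 0
  mono : MonotoneOn Φ (Set.Ici 0)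
  cont : ContinuousOn Φ (Set.Ici 0)
  growth : ∀ c x : ℝ, 2 ≤ c → 0 ≤ x → Φ (c * x) ≤ c ^ α * Φ x

section Probability

variable {Ω : Type*}

/-- Membership in the Orlicz space: `X` is a random variable with `E Ψ(|X| / c) < ∞` for some `c > 0`. -/
def MemOrlicz [MeasurableSpace Ω] (μ : Measure Ω) (Ψ : ℝ → ℝ) (X : Ω → ℝ) : Prop :=
  AEStronglyMeasurable X μ ∧ ∃ c : ℝ, 0 < c ∧ ∫⁻ ω, ENNReal.ofReal (Ψ (|X ω| / c)) ∂μ < ⊤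

/-- The Luxemburg norm `inf {c > 0 : E Ψ(|X| / c) ≤ 1}`, with values in `[0, ∞]`
(it is `∞` when there is no such `c`). -/
def orliczNorm [MeasurableSpace Ω] (μ : Measure Ω) (Ψ : ℝ → ℝ) (X : Ω → ℝ) : ENNReal :=
  ⨅ (c : ℝ) (_ : 0 < c ∧ ∫⁻ ω, ENNReal.ofReal (Ψ (|X ω| / c)) ∂μ ≤ 1), ENNReal.ofReal c

/-- The integer iterate `T ^ i` of a bijection. -/
def iter (T : Equiv.Perm Ω) (i : ℤ) : Ω → Ω := ⇑(T ^ i)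

/-- The stationary filtration `F_i = T^{-i}(F_0)`. -/
abbrev statFiltration (T : Equiv.Perm Ω) (F₀ : MeasurableSpace Ω) (i : ℤ) : MeasurableSpace Ω :=
  F₀.comap (iter T i)

/-- `F_{-∞} = ⋂_{n ≥ 0} F_{-n}`. -/
abbrev pastField (T : Equiv.Perm Ω) (F₀ : MeasurableSpace Ω) : MeasurableSpace Ω :=
  ⨅ n : ℕ, statFiltration T F₀ (-(n : ℤ))

/-- `F_∞ = ⋁_k F_k`. -/
abbrev totalField (T : Equiv.Perm Ω) (F₀ : MeasurableSpace Ω) : MeasurableSpace Ω :=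
  ⨆ k : ℤ, statFiltration T F₀ k

/-- The stationary sequence `ξ_i = ξ_0 ∘ T^i`. -/
def statSeq (T : Equiv.Perm Ω) (ξ₀ : Ω → ℝ) (i : ℤ) : Ω → ℝ := ξ₀ ∘ iter T i

/-- The projection `P_j(Z) = E(Z | F_j) - E(Z | F_{j-1})`. -/
def proj (F₀ : MeasurableSpace Ω) [MeasurableSpace Ω] (μ : Measure Ω) (T : Equiv.Perm Ω) (j : ℤ)
    (Z : Ω → ℝ) : Ω → ℝ :=
  μ[Z | statFiltration T F₀ j] - μ[Z | statFiltration T F₀ (j - 1)]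

/-- The series `∑_{i ∈ ℤ} f i` of square integrable random variables converges (unconditionally)
in `L²` to `g`. -/
def HasL2Sum [MeasurableSpace Ω] (μ : Measure Ω) (f : ℤ → Ω → ℝ) (g : Ω → ℝ) : Prop :=
  (∀ i, MemLp (f i) 2 μ) ∧ MemLp g 2 μ ∧
    Tendsto (fun s : Finset ℤ => eLpNorm ((∑ i ∈ s, f i) - g) 2 μ) atTop (𝓝 0)

open Classical in
/-- The sum in `L²` of the series `∑_{i ∈ ℤ} f i` (a representative, unique almost everywhere);
`0` if the series does not converge in `L²`. -/
def l2Sum [MeasurableSpace Ω] (μ : Measure Ω) (f : ℤ → Ω → ℝ) : Ω → ℝ :=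
  if h : ∃ g, HasL2Sum μ f g then h.choose else 0

/-- `d_j = ∑_{ℓ ∈ ℤ} P_j(ξ_ℓ)`. -/
def mdiff (F₀ : MeasurableSpace Ω) [MeasurableSpace Ω] (μ : Measure Ω) (T : Equiv.Perm Ω)
    (ξ₀ : Ω → ℝ) (j : ℤ) : Ω → ℝ :=
  l2Sum μ (fun l => proj F₀ μ T j (statSeq T ξ₀ l))

/-- The terms `a_j u_{k-j}`, `j ∈ ℤ`, of the linear process with coefficients `a` and innovations `u`. -/
def linTerm (a : ℤ → ℝ) (u : ℤ → Ω → ℝ) (k j : ℤ) : Ω → ℝ := a j • u (k - j)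

/-- The linear process `∑_j a_j u_{k-j}` with coefficients `a` and innovations `u`. -/
def linProc [MeasurableSpace Ω] (μ : Measure Ω) (a : ℤ → ℝ) (u : ℤ → Ω → ℝ) (k : ℤ) : Ω → ℝ :=
  l2Sum μ (linTerm a u k)

/-- The partial sum over `k = 1, …, n` of the linear process. -/
def linPartialSum [MeasurableSpace Ω] (μ : Measure Ω) (a : ℤ → ℝ) (u : ℤ → Ω → ℝ) (n : ℕ) : Ω → ℝ :=
  ∑ k ∈ Finset.Icc 1 n, linProc μ a u (k : ℤ)

end Probability

/-- `c_{n,j} = a_{1-j} + ⋯ + a_{n-j}`. -/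
def coefSum (a : ℤ → ℝ) (n : ℕ) (j : ℤ) : ℝ := ∑ k ∈ Finset.Icc 1 n, a ((k : ℤ) - j)

/-- `v_n² = ∑_j c_{n,j}²`. -/
def vSq (a : ℤ → ℝ) (n : ℕ) : ℝ := ∑' j : ℤ, coefSum a n j ^ 2

end

/-! Put D_k(j) = P_j(ξ_{j+k}). Regularity of ξ_0 gives ξ_i = ∑_k D_k(i-k), while d_i = ∑_k D_k(i).
Summing against the coefficients c_{n,i} and reindexing the first series, S_n - T_n = ∑_k ∑_j
(c_{n,j+k} - c_{n,j}) D_k(j). For fixed k the D_k(j) are stationary martingale differences in j.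

The analytic core is a type 2 inequality (`ClassA.orliczNorm_sum_le`): a sum of martingale
differences with weights b has Ψ-norm at most M‖b‖ times the common bound on the norms. Since
Ψ(x)/x² is nondecreasing and Ψ is doubling, the primitive of Ψ(s)/s is comparable to Ψ and has a
second-order Taylor bound. Conditioning removes the linear term, so each new difference multiplies 1
+ E(smoothed modular) by at most 1 + C b_j² ≤ exp(C b_j²).

It remains to bound the ℓ² norm of the k-shift increment of c_n. It is at most 2v_n, and also at
most |k| times the one-step increment, which telescopes to two shifts of a and is therefore bounded
by 2‖a‖ for every n. Using the first bound for |k| ≥ m and the second for |k| < m gives the estimate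
with v_n. The estimate with v_n² follows because v_n stays away from 0 for n ≥ 1 unless a = 0
(`exists_le_sqrt_vSq`).

All series live in L²: Ψ grows at least quadratically, so the Ψ-norm dominates the L² norm, and for
each k the D_k(j) are orthogonal. Limits return to the Ψ-norm by Fatou's lemma. -/

namespace ClassA

/-! ### Quadratic growth and smoothing of the Young function -/

variable {α : ℝ} {Ψ : ℝ → ℝ}

/-- Convexity of Ψ∘√ on the chord from 0 to x², taken at the point t²x². -/
theorem map_mul_le_sq (hΨ : ClassA α Ψ)
    (hsq : ConvexOn ℝ (Set.Ici 0) (fun x => Ψ (Real.sqrt x))) {t x : ℝ} (ht : 0 ≤ t) (ht1 : t ≤ 1)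
    (hx : 0 ≤ x) : Ψ (t * x) ≤ t ^ 2 * Ψ x := by
  have h := hsq.2 (x := x ^ 2) (y := 0) (by simp [sq_nonneg]) (by simp) (sq_nonneg t)
    (sub_nonneg.2 (pow_le_one₀ (n := 2) ht ht1)) (by ring)
  simpa [hΨ.map_zero, Real.sqrt_mul (sq_nonneg t), Real.sqrt_sq, ht, hx] using h

theorem map_two_mul_le (hΨ : ClassA α Ψ) {x : ℝ} (hx : 0 ≤ x) : Ψ (2 * x) ≤ 2 ^ α * Ψ x :=
  hΨ.growth 2 x le_rfl hx

theorem mono' (hΨ : ClassA α Ψ) {x y : ℝ} (hx : 0 ≤ x) (hxy : x ≤ y) : Ψ x ≤ Ψ y :=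
  hΨ.mono hx (hx.trans hxy) hxy

theorem div_sq_le_div_sq (hΨ : ClassA α Ψ)
    (hsq : ConvexOn ℝ (Set.Ici 0) (fun x => Ψ (Real.sqrt x))) {x y : ℝ} (hx : 0 < x) (hxy : x ≤ y) :
    Ψ x / x ^ 2 ≤ Ψ y / y ^ 2 := by
  have hy := hx.trans_le hxy
  have h := hΨ.map_mul_le_sq hsq (t := x / y) (by positivity) (div_le_one_of_le₀ hxy hy.le) hy.le
  rw [div_mul_cancel₀ _ hy.ne'] at h
  rw [div_le_iff₀ (by positivity)]
  calc Ψ x ≤ _ := h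
    _ = _ := by field_simp

/-- The derivative of the smoothed Young function. -/
noncomputable def slope (Ψ : ℝ → ℝ) (x : ℝ) : ℝ := Ψ |x| / x

theorem slope_neg (Ψ : ℝ → ℝ) (x : ℝ) : slope Ψ (-x) = -slope Ψ x := by
  simp [slope, div_neg]

theorem slope_zero (Ψ : ℝ → ℝ) : slope Ψ 0 = 0 := by simp [slope]

theorem slope_nonneg (hΨ : ClassA α Ψ) {x : ℝ} (hx : 0 ≤ x) : 0 ≤ slope Ψ x :=
  div_nonneg (hΨ.nonneg _ (abs_nonneg _)) hx

theorem slope_mul_self (hΨ : ClassA α Ψ) (x : ℝ) : slope Ψ x * x = Ψ |x| := by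
  rcases eq_or_ne x 0 with rfl | hx
  · simp [hΨ.map_zero]
  · exact div_mul_cancel₀ _ hx

theorem slope_monotone (hΨ : ClassA α Ψ)
    (hsq : ConvexOn ℝ (Set.Ici 0) (fun x => Ψ (Real.sqrt x))) : Monotone (slope Ψ) := by
  have key : ∀ x y : ℝ, 0 ≤ x → x ≤ y → slope Ψ x ≤ slope Ψ y := by
    intro x y hx hxy
    rcases hx.eq_or_lt with rfl | hx
    · rw [slope_zero]; exact hΨ.slope_nonneg hxy
    have hy := hx.trans_le hxy
    have h := hΨ.div_sq_le_div_sq hsq hx hxy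
    have e : ∀ z : ℝ, 0 < z → slope Ψ z = z * (Ψ z / z ^ 2) := fun z hz => by
      rw [slope, abs_of_pos hz]; field_simp
    rw [e x hx, e y hy]
    exact mul_le_mul hxy h (div_nonneg (hΨ.nonneg _ hx.le) (by positivity)) hy.le
  intro x y hxy
  rcases le_total 0 x with hx | hx
  · exact key x y hx hxy
  rcases le_total 0 y with hy | hy
  · have h1 := hΨ.slope_nonneg hy
    have h2 := hΨ.slope_nonneg (neg_nonneg.2 hx)
    rw [slope_neg] at h2
    linarith
  · have := key (-y) (-x) (by linarith) (by linarith)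
    rw [slope_neg, slope_neg] at this
    linarith

/-- This replaces a second-derivative bound for `smooth Ψ`, with no differentiability of Ψ. By
convexity the difference quotient of Ψ on [x, u] is at most the one on [u, 2u], hence at most 2^α
Ψ(u)/u by doubling. Dividing by u once more gives Ψ(u)/u², which is monotone in u. -/
theorem slope_sub_le (hΨ : ClassA α Ψ) (hconv : ConvexOn ℝ (Set.Ici 0) Ψ)
    (hsq : ConvexOn ℝ (Set.Ici 0) (fun x => Ψ (Real.sqrt x))) {x u R : ℝ} (hxu : x ≤ u)
    (hx : -R ≤ x) (hu : u ≤ R) :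
    slope Ψ u - slope Ψ x ≤ 2 ^ α * (Ψ R / R ^ 2) * (u - x) := by
  have key : ∀ x u : ℝ, 0 ≤ x → x ≤ u → u ≤ R →
      slope Ψ u - slope Ψ x ≤ 2 ^ α * (Ψ R / R ^ 2) * (u - x) := by
    intro x u hx hxu hu
    rcases hxu.eq_or_lt with rfl | hxu
    · simp
    have hu0 := hx.trans_lt hxu
    have h1 : slope Ψ u - slope Ψ x ≤ (Ψ u - Ψ x) / u := by
      have : Ψ x / u ≤ slope Ψ x := by
        rcases hx.eq_or_lt with rfl | hx
        · simp [slope, hΨ.map_zero]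
        · rw [slope, abs_of_pos hx]
          exact div_le_div_of_nonneg_left (hΨ.nonneg _ hx.le) hx hxu.le
      rw [sub_div]
      have : slope Ψ u = Ψ u / u := by rw [slope, abs_of_pos hu0]
      linarith
    have h2 := hconv.slope_mono_adjacent (x := x) (y := u) (z := 2 * u) hx
      (show (0 : ℝ) ≤ 2 * u by linarith) hxu (by linarith)
    have h3 := hΨ.map_two_mul_le hu0.le
    have h4 := hΨ.nonneg u hu0.le
    have h5 : Ψ u - Ψ x ≤ 2 ^ α * Ψ u / u * (u - x) := by
      rw [div_le_iff₀ (by linarith)] at h2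
      refine h2.trans (mul_le_mul_of_nonneg_right ?_ (by linarith))
      rw [show 2 * u - u = u by ring]
      exact div_le_div_of_nonneg_right (by linarith) hu0.le
    have h6 := hΨ.div_sq_le_div_sq hsq hu0 hu
    calc slope Ψ u - slope Ψ x ≤ (Ψ u - Ψ x) / u := h1
      _ ≤ (2 ^ α * Ψ u / u * (u - x)) / u := div_le_div_of_nonneg_right h5 hu0.le
      _ = 2 ^ α * (Ψ u / u ^ 2) * (u - x) := by field_simp
      _ ≤ _ := by
        refine mul_le_mul_of_nonneg_right (mul_le_mul_of_nonneg_left h6 (by positivity)) ?_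
        linarith
  rcases le_total 0 x with h0 | h0
  · exact key x u h0 hxu hu
  -- For x ≤ 0 ≤ u, oddness of the slope allows the estimates on [0, u] and [0, -x] to be added.
  rcases le_total 0 u with h0' | h0'
  · have h1 := key 0 u le_rfl h0' hu
    have h2 := key 0 (-x) le_rfl (by linarith) (by linarith)
    rw [slope_neg] at h2
    simp only [slope_zero] at h1 h2
    linarith
  · have := key (-u) (-x) (by linarith) (by linarith) (by linarith)
    rw [slope_neg, slope_neg] at this
    linarith

theorem slope_sub_mul_le (hΨ : ClassA α Ψ) (hconv : ConvexOn ℝ (Set.Ici 0) Ψ)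
    (hsq : ConvexOn ℝ (Set.Ici 0) (fun x => Ψ (Real.sqrt x))) {x u R : ℝ}
    (hx : |x| ≤ R) (hu : |u| ≤ R) :
    (slope Ψ u - slope Ψ x) * (u - x) ≤ 2 ^ α * (Ψ R / R ^ 2) * (u - x) ^ 2 := by
  obtain ⟨hx1, hx2⟩ := abs_le.1 hx
  obtain ⟨hu1, hu2⟩ := abs_le.1 hu
  rcases le_total x u with h | h
  · have := mul_le_mul_of_nonneg_right (hΨ.slope_sub_le hconv hsq h hx1 hu2) (sub_nonneg.2 h)
    linarith
  · have := mul_le_mul_of_nonneg_right (hΨ.slope_sub_le hconv hsq h hu1 hx2) (sub_nonneg.2 h)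
    linarith

/-- The smoothed Young function `x ↦ ∫_0^|x| Ψ s / s ds`. -/
noncomputable def smooth (Ψ : ℝ → ℝ) (x : ℝ) : ℝ := ∫ s in (0 : ℝ)..x, slope Ψ s

/-- A primitive of a monotone function is convex; this is its tangent-line inequality at `v`. -/
theorem smooth_sub_le (hΨ : ClassA α Ψ)
    (hsq : ConvexOn ℝ (Set.Ici 0) (fun x => Ψ (Real.sqrt x))) (u v : ℝ) :
    smooth Ψ v - smooth Ψ u ≤ slope Ψ v * (v - u) := by
  have hm := hΨ.slope_monotone hsq
  have hi : ∀ a b, IntervalIntegrable (slope Ψ) volume a b := fun a b => hm.intervalIntegrable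
  rw [smooth, smooth, intervalIntegral.integral_interval_sub_left (hi _ _) (hi _ _)]
  rcases le_total u v with h | h
  · calc ∫ s in u..v, slope Ψ s ≤ ∫ _ in u..v, slope Ψ v :=
          intervalIntegral.integral_mono_on h (hi _ _) (by simp) fun s hs => hm hs.2
      _ = _ := by simp [mul_comm]
  · rw [intervalIntegral.integral_symm]
    have : ∫ _ in v..u, slope Ψ v ≤ ∫ s in v..u, slope Ψ s :=
      intervalIntegral.integral_mono_on h (by simp) (hi _ _) fun s hs => hm hs.1
    simp only [intervalIntegral.integral_const, smul_eq_mul] at this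
    linarith

theorem smooth_zero (Ψ : ℝ → ℝ) : smooth Ψ 0 = 0 := by simp [smooth]

theorem smooth_nonneg (hΨ : ClassA α Ψ)
    (hsq : ConvexOn ℝ (Set.Ici 0) (fun x => Ψ (Real.sqrt x))) (x : ℝ) : 0 ≤ smooth Ψ x := by
  have := hΨ.smooth_sub_le hsq x 0
  simp only [smooth_zero, slope_zero] at this
  linarith

theorem smooth_le (hΨ : ClassA α Ψ)
    (hsq : ConvexOn ℝ (Set.Ici 0) (fun x => Ψ (Real.sqrt x))) (x : ℝ) : smooth Ψ x ≤ Ψ |x| := by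
  have := hΨ.smooth_sub_le hsq 0 x
  simpa only [smooth_zero, sub_zero, hΨ.slope_mul_self] using this

/-- The tangent line at x/2, evaluated at x, shows that the smoothed function at x is at least
Ψ(|x|/2); doubling finishes. -/
theorem le_smooth (hΨ : ClassA α Ψ)
    (hsq : ConvexOn ℝ (Set.Ici 0) (fun x => Ψ (Real.sqrt x))) (x : ℝ) :
    Ψ |x| ≤ 2 ^ α * smooth Ψ x := by
  have h1 := hΨ.smooth_sub_le hsq x (x / 2)
  have h2 := hΨ.smooth_nonneg hsq (x / 2)
  have h3 := hΨ.slope_mul_self (x / 2)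
  have h4 := hΨ.map_two_mul_le (abs_nonneg (x / 2))
  rw [show 2 * |x / 2| = |x| by rw [abs_div, abs_two]; ring] at h4
  refine h4.trans (mul_le_mul_of_nonneg_left ?_ (by positivity))
  have h5 : slope Ψ (x / 2) * (x / 2 - x) = -(slope Ψ (x / 2) * (x / 2)) := by ring
  linarith

theorem smooth_continuous (hΨ : ClassA α Ψ)
    (hsq : ConvexOn ℝ (Set.Ici 0) (fun x => Ψ (Real.sqrt x))) : Continuous (smooth Ψ) :=
  intervalIntegral.continuous_primitive (fun _ _ => (hΨ.slope_monotone hsq).intervalIntegrable) 0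

theorem map_max_le (hΨ : ClassA α Ψ) (x z : ℝ) : Ψ (max |x| |z|) ≤ Ψ |x| + Ψ |z| := by
  have h1 := hΨ.nonneg _ (abs_nonneg x)
  have h2 := hΨ.nonneg _ (abs_nonneg z)
  rcases max_choice |x| |z| with h | h <;> rw [h] <;> linarith

theorem map_abs_add_le (hΨ : ClassA α Ψ) (x z : ℝ) :
    Ψ |x + z| ≤ 2 ^ α * (Ψ |x| + Ψ |z|) := by
  have h : |x + z| ≤ 2 * max |x| |z| := by
    have := abs_add_le x z
    have := le_max_left |x| |z|
    have := le_max_right |x| |z|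
    linarith
  have h0 : 0 ≤ max |x| |z| := (abs_nonneg x).trans (le_max_left _ _)
  exact (hΨ.mono' (abs_nonneg _) h).trans ((hΨ.map_two_mul_le h0).trans
    (mul_le_mul_of_nonneg_left (hΨ.map_max_le x z) (by positivity)))

/-- A second-order Taylor bound: the tangent at x + tz, with its slope compared to the slope at x by
the Lipschitz estimate. Keeping the factor t² is what yields type 2. -/
theorem smooth_add_le (hΨ : ClassA α Ψ) (hconv : ConvexOn ℝ (Set.Ici 0) Ψ)
    (hsq : ConvexOn ℝ (Set.Ici 0) (fun x => Ψ (Real.sqrt x))) (x z : ℝ) {t : ℝ} (ht : |t| ≤ 1) :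
    smooth Ψ (x + t * z) ≤ smooth Ψ x + slope Ψ x * (t * z) +
      2 ^ α * 2 ^ α * t ^ 2 * (Ψ |x| + Ψ |z|) := by
  have h0 := hΨ.smooth_sub_le hsq x (x + t * z)
  set M := max |x| |z| with hM
  have hxM : |x| ≤ M := le_max_left _ _
  have hzM : |z| ≤ M := le_max_right _ _
  have hM0 : 0 ≤ M := (abs_nonneg x).trans hxM
  have htz : |t * z| ≤ M := by
    rw [abs_mul]
    exact (mul_le_of_le_one_left (abs_nonneg _) ht).trans hzM
  -- Both x and x + tz lie in [-2M, 2M], because |t| ≤ 1.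
  have h1 := hΨ.slope_sub_mul_le hconv hsq (x := x) (u := x + t * z) (R := 2 * M)
    (by linarith) ((abs_add_le _ _).trans (by linarith))
  rw [add_sub_cancel_left] at h0 h1
  have hnn := hΨ.nonneg (2 * M) (by linarith)
  have h2 : Ψ (2 * M) / (2 * M) ^ 2 * (t * z) ^ 2 ≤ t ^ 2 * Ψ (2 * M) := by
    rcases hM0.eq_or_lt with h | h
    · rw [← h]; simp [hΨ.map_zero]
    rw [div_mul_eq_mul_div, div_le_iff₀ (by positivity)]
    have hz2 : z ^ 2 ≤ (2 * M) ^ 2 := by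
      rw [← sq_abs z]; exact pow_le_pow_left₀ (abs_nonneg _) (by linarith) 2
    have := mul_le_mul_of_nonneg_left hz2 (mul_nonneg (sq_nonneg t) hnn)
    linarith
  have h3 : Ψ (2 * M) ≤ 2 ^ α * (Ψ |x| + Ψ |z|) := (hΨ.map_two_mul_le hM0).trans
    (mul_le_mul_of_nonneg_left (hΨ.map_max_le x z) (by positivity))
  have hc : (0 : ℝ) < 2 ^ α := by positivity
  have h4 : 2 ^ α * (Ψ (2 * M) / (2 * M) ^ 2) * (t * z) ^ 2 ≤
      2 ^ α * 2 ^ α * t ^ 2 * (Ψ |x| + Ψ |z|) := by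
    calc _ = 2 ^ α * (Ψ (2 * M) / (2 * M) ^ 2 * (t * z) ^ 2) := by ring
      _ ≤ 2 ^ α * (t ^ 2 * (2 ^ α * (Ψ |x| + Ψ |z|))) := 
          mul_le_mul_of_nonneg_left (h2.trans (mul_le_mul_of_nonneg_left h3 (sq_nonneg t))) hc.le
      _ = _ := by ring
  linarith

/-- Replacing both arguments by the larger modulus gives Ψ of the maximum. This makes the linear
Taylor term integrable. -/
theorem abs_slope_mul_le (hΨ : ClassA α Ψ)
    (hsq : ConvexOn ℝ (Set.Ici 0) (fun x => Ψ (Real.sqrt x))) (x z : ℝ) :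
    |slope Ψ x * z| ≤ Ψ |x| + Ψ |z| := by
  have e : |slope Ψ x| = slope Ψ |x| := by
    rw [slope, slope, abs_div, abs_abs, abs_of_nonneg (hΨ.nonneg _ (abs_nonneg _))]
  have hM0 : 0 ≤ max |x| |z| := (abs_nonneg x).trans (le_max_left _ _)
  rw [abs_mul, e]
  calc slope Ψ |x| * |z| ≤ slope Ψ (max |x| |z|) * max |x| |z| :=
        mul_le_mul (hΨ.slope_monotone hsq (le_max_left _ _)) (le_max_right _ _) (abs_nonneg _)
          (hΨ.slope_nonneg hM0)
    _ = Ψ (max |x| |z|) := by rw [hΨ.slope_mul_self, abs_of_nonneg hM0]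
    _ ≤ _ := hΨ.map_max_le x z

theorem continuous_comp_abs (hΨ : ClassA α Ψ) : Continuous fun x : ℝ => Ψ |x| :=
  hΨ.cont.comp_continuous continuous_abs fun x => abs_nonneg x

end ClassA

/-! ### The Luxemburg norm: Fatou property, triangle inequality, comparison with L² -/

section Orlicz

variable {Ω : Type*} [MeasurableSpace Ω] {μ : Measure Ω} {α : ℝ} {Ψ : ℝ → ℝ}

theorem ClassA.aemeasurable_ofReal (hΨ : ClassA α Ψ) {X : Ω → ℝ} (hX : AEMeasurable X μ) {c : ℝ}
    (hc : 0 < c) : AEMeasurable (fun ω => ENNReal.ofReal (Ψ (|X ω| / c))) μ := by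
  have h : (fun ω => Ψ (|X ω| / c)) = (fun x : ℝ => Ψ |x|) ∘ fun ω => X ω / c := by
    ext ω; simp [abs_div, abs_of_pos hc]
  have : AEMeasurable (fun ω => Ψ (|X ω| / c)) μ := by
    rw [h]
    exact hΨ.continuous_comp_abs.measurable.comp_aemeasurable (hX.div_const c)
  exact this.ennreal_ofReal

theorem orliczNorm_le_of_lintegral_le {X : Ω → ℝ} {c : ℝ} (hc : 0 < c)
    (h : ∫⁻ ω, ENNReal.ofReal (Ψ (|X ω| / c)) ∂μ ≤ 1) : orliczNorm μ Ψ X ≤ ENNReal.ofReal c :=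
  iInf₂_le c ⟨hc, h⟩

theorem ClassA.lintegral_le_one_of_lt (hΨ : ClassA α Ψ) {X : Ω → ℝ} {c : ℝ} (hc : 0 < c)
    (h : orliczNorm μ Ψ X < ENNReal.ofReal c) : ∫⁻ ω, ENNReal.ofReal (Ψ (|X ω| / c)) ∂μ ≤ 1 := by
  simp only [orliczNorm, iInf_lt_iff] at h
  obtain ⟨c', ⟨hc', h1⟩, h2⟩ := h
  refine le_trans (lintegral_mono fun ω => ENNReal.ofReal_le_ofReal (hΨ.mono' (by positivity) ?_)) h1
  exact div_le_div_of_nonneg_left (abs_nonneg _) hc' ((ENNReal.ofReal_lt_ofReal_iff hc).1 h2).le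

/-- Fatou's lemma combined with continuity of Ψ. -/
theorem ClassA.lintegral_le_one_of_tendsto (hΨ : ClassA α Ψ) {X : ℕ → Ω → ℝ} {Y : Ω → ℝ}
    {c : ℕ → ℝ} {d : ℝ} (hX : ∀ n, AEMeasurable (X n) μ) (hc : ∀ n, 0 < c n) (hd : 0 < d)
    (hcd : Tendsto c atTop (𝓝 d)) (hXY : ∀ᵐ ω ∂μ, Tendsto (fun n => X n ω) atTop (𝓝 (Y ω)))
    (h : ∀ n, ∫⁻ ω, ENNReal.ofReal (Ψ (|X n ω| / c n)) ∂μ ≤ 1) :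
    ∫⁻ ω, ENNReal.ofReal (Ψ (|Y ω| / d)) ∂μ ≤ 1 := by
  calc ∫⁻ ω, ENNReal.ofReal (Ψ (|Y ω| / d)) ∂μ
      = ∫⁻ ω, liminf (fun n => ENNReal.ofReal (Ψ (|X n ω| / c n))) atTop ∂μ := by
        refine lintegral_congr_ae ?_
        filter_upwards [hXY] with ω hω
        have h1 : Tendsto (fun n => X n ω / c n) atTop (𝓝 (Y ω / d)) := hω.div hcd hd.ne'
        have h2 := ((ENNReal.continuous_ofReal.comp hΨ.continuous_comp_abs).tendsto _).comp h1
        have e : ∀ n, |X n ω / c n| = |X n ω| / c n := fun n => by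
          rw [abs_div, abs_of_pos (hc n)]
        have e' : |Y ω / d| = |Y ω| / d := by rw [abs_div, abs_of_pos hd]
        simp only [Function.comp_def, e, e'] at h2
        exact h2.liminf_eq.symm
    _ ≤ liminf (fun n => ∫⁻ ω, ENNReal.ofReal (Ψ (|X n ω| / c n)) ∂μ) atTop :=
        lintegral_liminf_le' fun n => hΨ.aemeasurable_ofReal (hX n) (hc n)
    _ ≤ 1 := by
        refine liminf_le_of_frequently_le' (Frequently.of_forall h)

theorem ENNReal.le_of_forall_ofReal_lt {a K : ENNReal}
    (h : ∀ c : ℝ, 0 < c → K < ENNReal.ofReal c → a ≤ ENNReal.ofReal c) : a ≤ K := by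
  refine le_of_forall_gt fun x hx => ?_
  obtain ⟨y, hy, hyx⟩ := exists_between hx
  have hy' : y ≠ ⊤ := (hyx.trans_le le_top).ne
  have e : ENNReal.ofReal y.toReal = y := ENNReal.ofReal_toReal hy'
  have := h y.toReal (ENNReal.toReal_pos (bot_le.trans_lt hy).ne' hy') (by rwa [e])
  rw [e] at this
  exact this.trans_lt hyx

theorem ClassA.orliczNorm_le_of_tendsto_ae (hΨ : ClassA α Ψ) {X : ℕ → Ω → ℝ} {Y : Ω → ℝ}
    {K : ENNReal} (hX : ∀ n, AEMeasurable (X n) μ)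
    (hXY : ∀ᵐ ω ∂μ, Tendsto (fun n => X n ω) atTop (𝓝 (Y ω)))
    (h : ∀ n, orliczNorm μ Ψ (X n) ≤ K) : orliczNorm μ Ψ Y ≤ K := by
  refine ENNReal.le_of_forall_ofReal_lt fun c hc hK => orliczNorm_le_of_lintegral_le hc ?_
  exact hΨ.lintegral_le_one_of_tendsto hX (fun _ => hc) hc tendsto_const_nhds hXY fun n =>
    hΨ.lintegral_le_one_of_lt hc ((h n).trans_lt hK)

/-- An L²-convergent family has an almost surely convergent subsequence, to which Fatou applies.
Bounds on finite sums thus pass to L² sums with no convergence in the Ψ-norm. -/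
theorem ClassA.orliczNorm_le_of_tendsto_eLpNorm (hΨ : ClassA α Ψ) {ι : Type*} {l : Filter ι}
    [l.NeBot] [l.IsCountablyGenerated] {X : ι → Ω → ℝ} {Y : Ω → ℝ} {K : ENNReal}
    (hX : ∀ i, AEStronglyMeasurable (X i) μ) (hY : AEStronglyMeasurable Y μ)
    (hXY : Tendsto (fun i => eLpNorm (X i - Y) 2 μ) l (𝓝 0))
    (h : ∀ i, orliczNorm μ Ψ (X i) ≤ K) : orliczNorm μ Ψ Y ≤ K := by
  obtain ⟨ns, -, hns⟩ := (tendstoInMeasure_of_tendsto_eLpNorm two_ne_zero hX hY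
    hXY).exists_seq_tendsto_ae'
  exact hΨ.orliczNorm_le_of_tendsto_ae (fun n => (hX _).aemeasurable) hns fun n => h _

theorem ClassA.orliczNorm_Lp_le_of_tendsto (hΨ : ClassA α Ψ) {ι : Type*} {l : Filter ι}
    [l.NeBot] [l.IsCountablyGenerated] {X : ι → Lp ℝ 2 μ} {Y : Lp ℝ 2 μ} {K : ENNReal}
    (hXY : Tendsto X l (𝓝 Y)) (h : ∀ i, orliczNorm μ Ψ (X i) ≤ K) : orliczNorm μ Ψ Y ≤ K :=
  hΨ.orliczNorm_le_of_tendsto_eLpNorm (fun _ => Lp.aestronglyMeasurable _)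
    (Lp.aestronglyMeasurable _) ((Lp.tendsto_Lp_iff_tendsto_eLpNorm' _ _).1 hXY) h

theorem orliczNorm_congr_ae {X Y : Ω → ℝ} (h : X =ᵐ[μ] Y) : orliczNorm μ Ψ X = orliczNorm μ Ψ Y := by
  have : ∀ c : ℝ, ∫⁻ ω, ENNReal.ofReal (Ψ (|X ω| / c)) ∂μ =
      ∫⁻ ω, ENNReal.ofReal (Ψ (|Y ω| / c)) ∂μ := fun c =>
    lintegral_congr_ae (by filter_upwards [h] with ω hω; rw [hω])
  simp only [orliczNorm, this]

theorem ClassA.orliczNorm_zero (hΨ : ClassA α Ψ) : orliczNorm μ Ψ (0 : Ω → ℝ) = 0 := by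
  refine le_antisymm (ENNReal.le_of_forall_ofReal_lt fun c hc _ => ?_) bot_le
  exact orliczNorm_le_of_lintegral_le hc (by simp [hΨ.map_zero])

theorem orliczNorm_comp {T : Ω → Ω} (hT : MeasurePreserving T μ μ) (hT' : MeasurableEmbedding T)
    (X : Ω → ℝ) : orliczNorm μ Ψ (X ∘ T) = orliczNorm μ Ψ X := by
  have : ∀ c : ℝ, ∫⁻ ω, ENNReal.ofReal (Ψ (|(X ∘ T) ω| / c)) ∂μ =
      ∫⁻ ω, ENNReal.ofReal (Ψ (|X ω| / c)) ∂μ := fun c =>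
    hT.lintegral_comp_emb hT' fun ω => ENNReal.ofReal (Ψ (|X ω| / c))
  simp only [orliczNorm, this]

theorem ClassA.orliczNorm_add_le (hΨ : ClassA α Ψ) (hconv : ConvexOn ℝ (Set.Ici 0) Ψ) {X Y : Ω → ℝ}
    (hX : AEMeasurable X μ) (hY : AEMeasurable Y μ) :
    orliczNorm μ Ψ (X + Y) ≤ orliczNorm μ Ψ X + orliczNorm μ Ψ Y := by
  rw [orliczNorm, orliczNorm, orliczNorm]
  simp only [iInf_subtype', ENNReal.iInf_add, ENNReal.add_iInf]
  refine le_iInf fun ⟨b, hb, hYb⟩ => le_iInf fun ⟨a, ha, hXa⟩ => ?_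
  have hab := add_pos ha hb
  change _ ≤ ENNReal.ofReal a + ENNReal.ofReal b
  rw [← ENNReal.ofReal_add ha.le hb.le]
  refine iInf_le_of_le (ι := {c : ℝ // _}) ⟨a + b, hab, ?_⟩ le_rfl
  -- Convexity with weights a/(a+b) and b/(a+b) applied to |X|/a and |Y|/b.
  have hpt : ∀ ω, ENNReal.ofReal (Ψ (|(X + Y) ω| / (a + b))) ≤
      ENNReal.ofReal (a / (a + b)) * ENNReal.ofReal (Ψ (|X ω| / a)) +
      ENNReal.ofReal (b / (a + b)) * ENNReal.ofReal (Ψ (|Y ω| / b)) := by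
    intro ω
    have h1 := hΨ.nonneg (|X ω| / a) (by positivity)
    have h2 := hΨ.nonneg (|Y ω| / b) (by positivity)
    rw [← ENNReal.ofReal_mul (by positivity), ← ENNReal.ofReal_mul (by positivity),
      ← ENNReal.ofReal_add (by positivity) (by positivity)]
    refine ENNReal.ofReal_le_ofReal ?_
    have h3 := hconv.2 (show (0 : ℝ) ≤ |X ω| / a by positivity)
      (show (0 : ℝ) ≤ |Y ω| / b by positivity) (show 0 ≤ a / (a + b) by positivity)
      (show 0 ≤ b / (a + b) by positivity) (by field_simp)
    refine le_trans (hΨ.mono' (by positivity) ?_) h3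
    simp only [smul_eq_mul, Pi.add_apply]
    rw [div_le_iff₀ hab]
    calc |X ω + Y ω| ≤ |X ω| + |Y ω| := abs_add_le _ _
      _ = _ := by field_simp
  calc ∫⁻ ω, ENNReal.ofReal (Ψ (|(X + Y) ω| / (a + b))) ∂μ
      ≤ ENNReal.ofReal (a / (a + b)) * 1 + ENNReal.ofReal (b / (a + b)) * 1 := by
        refine (lintegral_mono hpt).trans ?_
        rw [lintegral_add_left' ((hΨ.aemeasurable_ofReal hX ha).const_mul _),
          lintegral_const_mul'' _ (hΨ.aemeasurable_ofReal hX ha),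
          lintegral_const_mul'' _ (hΨ.aemeasurable_ofReal hY hb)]
        gcongr
    _ = 1 := by
        rw [mul_one, mul_one, ← ENNReal.ofReal_add (by positivity) (by positivity), ← add_div,
          div_self hab.ne', ENNReal.ofReal_one]

theorem ClassA.orliczNorm_Lp_sum_le (hΨ : ClassA α Ψ) (hconv : ConvexOn ℝ (Set.Ici 0) Ψ) {ι : Type*}
    (s : Finset ι) (X : ι → Lp ℝ 2 μ) :
    orliczNorm μ Ψ (∑ i ∈ s, X i : Lp ℝ 2 μ) ≤ ∑ i ∈ s, orliczNorm μ Ψ (X i) := by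
  classical
  induction s using Finset.induction_on with
  | empty =>
    rw [Finset.sum_empty, Finset.sum_empty, orliczNorm_congr_ae (Lp.coeFn_zero ℝ 2 μ),
      hΨ.orliczNorm_zero]
  | insert i s hi ih =>
    rw [Finset.sum_insert hi, Finset.sum_insert hi, orliczNorm_congr_ae (Lp.coeFn_add _ _)]
    exact (hΨ.orliczNorm_add_le hconv (Lp.aestronglyMeasurable _).aemeasurable
      (Lp.aestronglyMeasurable _).aemeasurable).trans (by gcongr)

theorem ClassA.orliczNorm_Lp_le_of_hasSum (hΨ : ClassA α Ψ) (hconv : ConvexOn ℝ (Set.Ici 0) Ψ)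
    {ι : Type*} [Countable ι] {X : ι → Lp ℝ 2 μ} {Y : Lp ℝ 2 μ} (h : HasSum X Y) :
    orliczNorm μ Ψ Y ≤ ∑' i, orliczNorm μ Ψ (X i) :=
  hΨ.orliczNorm_Lp_le_of_tendsto h fun s =>
    (hΨ.orliczNorm_Lp_sum_le hconv s X).trans (ENNReal.sum_le_tsum s)

/-- Pick y with Ψ(y) > 0. Beyond y, monotonicity of Ψ(x)/x² gives x² ≤ (y²/Ψ(y)) Ψ(|x|); below y,
the constant y² suffices. -/
theorem ClassA.exists_sq_le (hΨ : ClassA α Ψ) (hne : ∃ x, 0 ≤ x ∧ Ψ x ≠ 0)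
    (hsq : ConvexOn ℝ (Set.Ici 0) (fun x => Ψ (Real.sqrt x))) :
    ∃ K : ℝ, 0 < K ∧ ∀ x, x ^ 2 ≤ K * (1 + Ψ |x|) := by
  obtain ⟨y, hy, hne⟩ := hne
  have hy0 : 0 < y := hy.lt_of_ne (by rintro rfl; exact hne hΨ.map_zero)
  have hΨy : 0 < Ψ y := (hΨ.nonneg y hy).lt_of_ne' hne
  refine ⟨y ^ 2 + y ^ 2 / Ψ y, by positivity, fun x => ?_⟩
  have hnn := hΨ.nonneg _ (abs_nonneg x)
  rcases le_total |x| y with h | h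
  · have : x ^ 2 ≤ y ^ 2 := by rw [← sq_abs]; exact pow_le_pow_left₀ (abs_nonneg _) h 2
    have h2 : 0 ≤ y ^ 2 / Ψ y := by positivity
    nlinarith [mul_nonneg h2 hnn, mul_nonneg (sq_nonneg y) hnn]
  · have h1 := hΨ.div_sq_le_div_sq hsq hy0 h
    have hx : 0 < |x| := hy0.trans_le h
    rw [div_le_div_iff₀ (by positivity) (by positivity), sq_abs] at h1
    have h3 : x ^ 2 ≤ y ^ 2 / Ψ y * Ψ |x| := by
      rw [div_mul_eq_mul_div, le_div_iff₀ hΨy]; linarith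
    have h2 : 0 ≤ y ^ 2 / Ψ y := by positivity
    nlinarith [mul_nonneg (sq_nonneg y) hnn, sq_nonneg y]

theorem lintegral_enorm_sq_le [IsProbabilityMeasure μ] {K : ℝ} (hK : 0 < K)
    (h : ∀ x, x ^ 2 ≤ K * (1 + Ψ |x|)) (hnn : ∀ x, 0 ≤ x → 0 ≤ Ψ x) (X : Ω → ℝ) {c : ℝ}
    (hc : 0 < c) :
    ∫⁻ ω, ‖X ω‖ₑ ^ 2 ∂μ ≤ ENNReal.ofReal c ^ 2 * (ENNReal.ofReal K *
      (1 + ∫⁻ ω, ENNReal.ofReal (Ψ (|X ω| / c)) ∂μ)) := by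
  calc ∫⁻ ω, ‖X ω‖ₑ ^ 2 ∂μ
      ≤ ∫⁻ ω, ENNReal.ofReal c ^ 2 * (ENNReal.ofReal K *
        (1 + ENNReal.ofReal (Ψ (|X ω| / c)))) ∂μ := by
        refine lintegral_mono fun ω => ?_
        have h1 := h (X ω / c)
        rw [abs_div, abs_of_pos hc, div_pow, div_le_iff₀ (by positivity)] at h1
        have h2 := hnn (|X ω| / c) (by positivity)
        rw [← ENNReal.ofReal_one, ← ENNReal.ofReal_add zero_le_one h2, ← ENNReal.ofReal_mul hK.le,
          ← ENNReal.ofReal_pow hc.le, ← ENNReal.ofReal_mul (by positivity), Real.enorm_eq_ofReal_abs,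
          ← ENNReal.ofReal_pow (abs_nonneg _), sq_abs]
        exact ENNReal.ofReal_le_ofReal (by linarith)
    _ = _ := by
        rw [lintegral_const_mul' _ _ (by finiteness), lintegral_const_mul' _ _ (by finiteness),
          lintegral_add_left measurable_const]
        simp

theorem ClassA.exists_eLpNorm_le [IsProbabilityMeasure μ] (hΨ : ClassA α Ψ)
    (hne : ∃ x, 0 ≤ x ∧ Ψ x ≠ 0) (hsq : ConvexOn ℝ (Set.Ici 0) (fun x => Ψ (Real.sqrt x))) :
    ∃ K : ENNReal, K ≠ ⊤ ∧ ∀ X : Ω → ℝ, eLpNorm X 2 μ ≤ K * orliczNorm μ Ψ X := by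
  obtain ⟨K, hK, h⟩ := hΨ.exists_sq_le hne hsq
  -- At an admissible level c the second moment is at most 2K c², and 2K ≤ (1 + 2K)² avoids a square
  -- root.
  refine ⟨ENNReal.ofReal (1 + 2 * K), by finiteness, fun X => ?_⟩
  have hK0 : ENNReal.ofReal (1 + 2 * K) ≠ 0 := by simp; linarith
  rw [orliczNorm, ENNReal.mul_iInf_of_ne hK0 (by finiteness)]
  refine le_iInf fun c => ?_
  rw [ENNReal.mul_iInf_of_ne hK0 (by finiteness)]
  refine le_iInf fun ⟨hc, hcX⟩ => ?_
  have h1 := lintegral_enorm_sq_le hK h hΨ.nonneg X hc (μ := μ)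
  have h2 : ENNReal.ofReal K * (1 + ∫⁻ ω, ENNReal.ofReal (Ψ (|X ω| / c)) ∂μ) ≤
      ENNReal.ofReal (1 + 2 * K) ^ 2 := by
    calc _ ≤ ENNReal.ofReal K * (1 + 1) := by gcongr
      _ = ENNReal.ofReal (2 * K) := by
        rw [one_add_one_eq_two, mul_comm, ENNReal.ofReal_mul zero_le_two]; simp
      _ ≤ _ := by
        rw [← ENNReal.ofReal_pow (by linarith)]
        exact ENNReal.ofReal_le_ofReal (by nlinarith)
  rw [eLpNorm_eq_lintegral_rpow_enorm_toReal two_ne_zero ENNReal.ofNat_ne_top]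
  simp only [ENNReal.toReal_ofNat, ENNReal.rpow_ofNat]
  rw [one_div, ENNReal.rpow_inv_le_iff two_pos, ENNReal.rpow_ofNat, mul_pow, mul_comm]
  exact h1.trans (by gcongr)

theorem ClassA.memLp_two [IsProbabilityMeasure μ] (hΨ : ClassA α Ψ)
    (hne : ∃ x, 0 ≤ x ∧ Ψ x ≠ 0) (hsq : ConvexOn ℝ (Set.Ici 0) (fun x => Ψ (Real.sqrt x)))
    {X : Ω → ℝ} (hX : MemOrlicz μ Ψ X) : MemLp X 2 μ := by
  obtain ⟨K, hK, h⟩ := hΨ.exists_sq_le hne hsq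
  obtain ⟨hm, c, hc, hcX⟩ := hX
  refine ⟨hm, ?_⟩
  rw [eLpNorm_lt_top_iff_lintegral_rpow_enorm_lt_top two_ne_zero ENNReal.ofNat_ne_top]
  simp only [ENNReal.toReal_ofNat, ENNReal.rpow_ofNat]
  refine (lintegral_enorm_sq_le hK h hΨ.nonneg X hc).trans_lt ?_
  finiteness

end Orlicz

/-! ### The type 2 inequality for martingale differences -/

section MartingaleType

variable {Ω : Type*} {m mΩ : MeasurableSpace Ω} {μ : Measure Ω} {α : ℝ} {Ψ : ℝ → ℝ}

theorem ClassA.integrable_abs_add (hΨ : ClassA α Ψ) {X Y : Ω → ℝ}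
    (hX : AEStronglyMeasurable X μ) (hY : AEStronglyMeasurable Y μ)
    (hXi : Integrable (fun ω => Ψ |X ω|) μ) (hYi : Integrable (fun ω => Ψ |Y ω|) μ) :
    Integrable (fun ω => Ψ |X ω + Y ω|) μ := by
  refine ((hXi.add hYi).const_mul (2 ^ α)).mono
    (hΨ.continuous_comp_abs.comp_aestronglyMeasurable (hX.add hY)) (ae_of_all _ fun ω => ?_)
  rw [Real.norm_of_nonneg (hΨ.nonneg _ (abs_nonneg _))]
  exact (hΨ.map_abs_add_le _ _).trans (le_abs_self _)

theorem ClassA.integrable_abs_mul (hΨ : ClassA α Ψ) {X : Ω → ℝ}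
    (hX : AEStronglyMeasurable X μ) (hXi : Integrable (fun ω => Ψ |X ω|) μ) {t : ℝ} (ht : |t| ≤ 1) :
    Integrable (fun ω => Ψ |t * X ω|) μ := by
  refine hXi.mono (hΨ.continuous_comp_abs.comp_aestronglyMeasurable (hX.const_mul t))
    (ae_of_all _ fun ω => ?_)
  rw [Real.norm_of_nonneg (hΨ.nonneg _ (abs_nonneg _)), Real.norm_of_nonneg (hΨ.nonneg _ (abs_nonneg _))]
  refine hΨ.mono' (abs_nonneg _) ?_
  rw [abs_mul]
  exact mul_le_of_le_one_left (abs_nonneg _) ht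

theorem ClassA.integrable_smooth (hΨ : ClassA α Ψ)
    (hsq : ConvexOn ℝ (Set.Ici 0) (fun x => Ψ (Real.sqrt x))) {X : Ω → ℝ}
    (hX : AEStronglyMeasurable X μ) (hXi : Integrable (fun ω => Ψ |X ω|) μ) :
    Integrable (fun ω => smooth Ψ (X ω)) μ := by
  refine hXi.mono ((hΨ.smooth_continuous hsq).comp_aestronglyMeasurable hX) (ae_of_all _ fun ω => ?_)
  rw [Real.norm_of_nonneg (hΨ.smooth_nonneg hsq _), Real.norm_of_nonneg (hΨ.nonneg _ (abs_nonneg _))]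
  exact hΨ.smooth_le hsq _

/-- Integrate the Taylor bound: the linear term is an `m`-measurable factor times a variable with
zero conditional mean, so its integral vanishes. -/
theorem ClassA.integral_smooth_add_le (hΨ : ClassA α Ψ) (hconv : ConvexOn ℝ (Set.Ici 0) Ψ)
    (hsq : ConvexOn ℝ (Set.Ici 0) (fun x => Ψ (Real.sqrt x))) (hm : m ≤ mΩ)
    [SigmaFinite (μ.trim hm)]
    {S Z : Ω → ℝ} (hS : StronglyMeasurable[m] S) (hZ : AEStronglyMeasurable Z μ)
    (hSi : Integrable (fun ω => Ψ |S ω|) μ) (hZi : Integrable (fun ω => Ψ |Z ω|) μ)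
    (hZint : Integrable Z μ) (hZ0 : μ[Z | m] =ᵐ[μ] 0) {t : ℝ} (ht : |t| ≤ 1) :
    ∫ ω, smooth Ψ (S ω + t * Z ω) ∂μ ≤ ∫ ω, smooth Ψ (S ω) ∂μ +
      2 ^ α * 2 ^ α * t ^ 2 * (∫ ω, Ψ |S ω| ∂μ + ∫ ω, Ψ |Z ω| ∂μ) := by
  have hS' : AEStronglyMeasurable S μ := (hS.mono hm).aestronglyMeasurable
  have hg : StronglyMeasurable[m] fun ω => slope Ψ (S ω) :=
    ((hΨ.slope_monotone hsq).measurable.comp hS.measurable).stronglyMeasurable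
  have hgZ : Integrable ((fun ω => slope Ψ (S ω)) * Z) μ := by
    refine (hSi.add hZi).mono ((hg.mono hm).aestronglyMeasurable.mul hZ) (ae_of_all _ fun ω => ?_)
    exact (hΨ.abs_slope_mul_le hsq _ _).trans (le_abs_self _)
  have h0 : ∫ ω, slope Ψ (S ω) * Z ω ∂μ = 0 := by
    have h1 := condExp_mul_of_stronglyMeasurable_left hg hgZ hZint
    have h2 := integral_condExp hm (f := (fun ω => slope Ψ (S ω)) * Z) (μ := μ)
    rw [integral_congr_ae h1] at h2
    simp only [Pi.mul_apply] at h2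
    rw [← h2]
    refine integral_eq_zero_of_ae ?_
    filter_upwards [hZ0] with ω hω
    simp [hω]
  have hi1 := hΨ.integrable_smooth hsq hS' hSi
  have hi2 : Integrable (fun ω => slope Ψ (S ω) * (t * Z ω)) μ := by
    refine (hgZ.const_mul t).congr (ae_of_all _ fun ω => ?_)
    simp only [Pi.mul_apply]; ring
  have hi3 : Integrable (fun ω => 2 ^ α * 2 ^ α * t ^ 2 * (Ψ |S ω| + Ψ |Z ω|)) μ :=
    (hSi.add hZi).const_mul _
  calc ∫ ω, smooth Ψ (S ω + t * Z ω) ∂μ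
      ≤ ∫ ω, (smooth Ψ (S ω) + slope Ψ (S ω) * (t * Z ω) +
          2 ^ α * 2 ^ α * t ^ 2 * (Ψ |S ω| + Ψ |Z ω|)) ∂μ := by
        refine integral_mono ?_ ((hi1.add hi2).add hi3)
          fun ω => hΨ.smooth_add_le hconv hsq (S ω) (Z ω) ht
        exact hΨ.integrable_smooth hsq (hS'.add (hZ.const_mul t))
          (hΨ.integrable_abs_add hS' (hZ.const_mul t) hSi (hΨ.integrable_abs_mul hZ hZi ht))
    _ = _ := by
        have h3 : ∫ ω, slope Ψ (S ω) * (t * Z ω) ∂μ = 0 := by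
          calc _ = ∫ ω, t * (slope Ψ (S ω) * Z ω) ∂μ := by congr 1; ext ω; ring
            _ = 0 := by rw [integral_const_mul, h0, mul_zero]
        have hi12 : Integrable (fun ω => smooth Ψ (S ω) + slope Ψ (S ω) * (t * Z ω)) μ := hi1.add hi2
        rw [integral_add hi12 hi3, integral_add hi1 hi2, h3, add_zero, integral_const_mul,
          integral_add hSi hZi]

/-- Exponential bound for the smoothed modular of a weighted sum of martingale differences. -/
theorem ClassA.integral_smooth_sum_le [IsProbabilityMeasure μ] (hΨ : ClassA α Ψ) (hα : 0 < α)
    (hconv : ConvexOn ℝ (Set.Ici 0) Ψ)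
    (hsq : ConvexOn ℝ (Set.Ici 0) (fun x => Ψ (Real.sqrt x))) {F : ℤ → MeasurableSpace Ω}
    (hF : Monotone F) (hFm : ∀ j, F j ≤ mΩ) {D : ℤ → Ω → ℝ}
    (hD : ∀ j, StronglyMeasurable[F j] (D j)) (hDi : ∀ j, Integrable (D j) μ)
    (hD0 : ∀ j, μ[D j | F (j - 1)] =ᵐ[μ] 0) (hDΨ : ∀ j, Integrable (fun ω => Ψ |D j ω|) μ)
    (hD1 : ∀ j, ∫ ω, Ψ |D j ω| ∂μ ≤ 1) {b : ℤ → ℝ} (s : Finset ℤ) (hb : ∀ j ∈ s, |b j| ≤ 1) :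
    Integrable (fun ω => Ψ |∑ j ∈ s, b j * D j ω|) μ ∧
      1 + ∫ ω, smooth Ψ (∑ j ∈ s, b j * D j ω) ∂μ ≤
        Real.exp (2 ^ α * 2 ^ α * 2 ^ α * ∑ j ∈ s, b j ^ 2) := by
  induction s using Finset.induction_on_max with
  | empty => simp [hΨ.map_zero, smooth_zero]
  -- The largest index enters last, so the sum over `s` is measurable for F (a-1) and D a is a
  -- martingale difference relative to it.
  | insert a s has ih =>
    obtain ⟨ih1, ih2⟩ := ih fun j hj => hb j (Finset.mem_insert_of_mem hj)
    have ha : a ∉ s := fun h => lt_irrefl _ (has a h)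
    have hba := hb a (Finset.mem_insert_self _ _)
    have hSm : StronglyMeasurable[F (a - 1)] fun ω => ∑ j ∈ s, b j * D j ω := by
      refine Finset.stronglyMeasurable_fun_sum s fun j hj => ?_
      have hja := has j hj
      exact ((hD j).mono (hF (show j ≤ a - 1 by omega))).const_mul (b j)
    have hSm' := (hSm.mono (hFm _)).aestronglyMeasurable (μ := μ)
    have hDm : AEStronglyMeasurable (D a) μ := ((hD a).mono (hFm a)).aestronglyMeasurable
    simp only [Finset.sum_insert ha]
    have e : ∀ ω, b a * D a ω + ∑ j ∈ s, b j * D j ω = ∑ j ∈ s, b j * D j ω + b a * D a ω :=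
      fun ω => add_comm _ _
    simp only [e]
    refine ⟨hΨ.integrable_abs_add hSm' (hDm.const_mul _) ih1
      (hΨ.integrable_abs_mul hDm (hDΨ a) hba), ?_⟩
    have h1 := hΨ.integral_smooth_add_le hconv hsq (hFm (a - 1)) hSm hDm ih1 (hDΨ a) (hDi a)
      (hD0 a) hba
    have h2 : ∫ ω, Ψ |∑ j ∈ s, b j * D j ω| ∂μ ≤
        2 ^ α * ∫ ω, smooth Ψ (∑ j ∈ s, b j * D j ω) ∂μ := by
      rw [← integral_const_mul]
      exact integral_mono ih1 ((hΨ.integrable_smooth hsq hSm' ih1).const_mul _)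
        fun ω => hΨ.le_smooth hsq _
    have h3 : 0 ≤ ∫ ω, smooth Ψ (∑ j ∈ s, b j * D j ω) ∂μ :=
      integral_nonneg fun ω => hΨ.smooth_nonneg hsq _
    set A := ∫ ω, smooth Ψ (∑ j ∈ s, b j * D j ω) ∂μ
    have hc : (1 : ℝ) ≤ 2 ^ α := Real.one_le_rpow one_le_two hα.le
    set K : ℝ := 2 ^ α
    -- The modular of D a is at most 1 ≤ K. The added 1 makes the recursion purely multiplicative.
    have h4 : ∫ ω, Ψ |∑ j ∈ s, b j * D j ω| ∂μ + ∫ ω, Ψ |D a ω| ∂μ ≤ K * (1 + A) := by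
      have := hD1 a
      linarith
    calc 1 + ∫ ω, smooth Ψ (∑ j ∈ s, b j * D j ω + b a * D a ω) ∂μ
        ≤ 1 + (A + K * K * b a ^ 2 * (K * (1 + A))) := by
          have := mul_le_mul_of_nonneg_left h4 (show 0 ≤ K * K * b a ^ 2 by positivity)
          linarith
      _ = (K * K * K * b a ^ 2 + 1) * (1 + A) := by ring
      _ ≤ Real.exp (K * K * K * b a ^ 2) * Real.exp (K * K * K * ∑ j ∈ s, b j ^ 2) :=
          mul_le_mul (Real.add_one_le_exp _) ih2 (by positivity) (by positivity)
      _ = _ := by rw [← Real.exp_add]; ring_nf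

/-- The constant in the martingale inequality `ClassA.orliczNorm_sum_le`. -/
noncomputable def martConst (α : ℝ) : ℝ := 2 ^ α * Real.exp (2 ^ α * 2 ^ α * 2 ^ α)

theorem martConst_pos (α : ℝ) : 0 < martConst α := by unfold martConst; positivity

theorem one_le_martConst {α : ℝ} (hα : 0 < α) : 1 ≤ martConst α :=
  one_le_mul_of_one_le_of_one_le (Real.one_le_rpow one_le_two hα.le)
    (Real.one_le_exp (by positivity))

theorem ClassA.lintegral_sum_le_one [IsProbabilityMeasure μ] (hΨ : ClassA α Ψ) (hα : 0 < α)
    (hconv : ConvexOn ℝ (Set.Ici 0) Ψ)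
    (hsq : ConvexOn ℝ (Set.Ici 0) (fun x => Ψ (Real.sqrt x))) {F : ℤ → MeasurableSpace Ω}
    (hF : Monotone F) (hFm : ∀ j, F j ≤ mΩ) {D : ℤ → Ω → ℝ}
    (hD : ∀ j, StronglyMeasurable[F j] (D j)) (hDi : ∀ j, Integrable (D j) μ)
    (hD0 : ∀ j, μ[D j | F (j - 1)] =ᵐ[μ] 0)
    (hD1 : ∀ j, ∫⁻ ω, ENNReal.ofReal (Ψ |D j ω|) ∂μ ≤ 1) {b : ℤ → ℝ} (s : Finset ℤ)
    (hb : ∑ j ∈ s, b j ^ 2 ≤ 1) :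
    ∫⁻ ω, ENNReal.ofReal (Ψ (|∑ j ∈ s, b j * D j ω| / martConst α)) ∂μ ≤ 1 := by
  have hnn : ∀ x : ℝ, 0 ≤ Ψ |x| := fun x => hΨ.nonneg _ (abs_nonneg x)
  have hDΨ : ∀ j, Integrable (fun ω => Ψ |D j ω|) μ := fun j =>
    ⟨hΨ.continuous_comp_abs.comp_aestronglyMeasurable
      ((hD j).mono (hFm j)).aestronglyMeasurable, by
      rw [hasFiniteIntegral_iff_ofReal (ae_of_all _ fun ω => hnn _)]
      exact (hD1 j).trans_lt ENNReal.one_lt_top⟩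
  have hD1' : ∀ j, ∫ ω, Ψ |D j ω| ∂μ ≤ 1 := fun j => by
    have h := hD1 j
    rw [← ofReal_integral_eq_lintegral_ofReal (hDΨ j) (ae_of_all _ fun ω => hnn _)] at h
    exact ENNReal.ofReal_le_one.1 h
  have hb' : ∀ j ∈ s, |b j| ≤ 1 := fun j hj => by
    rw [← sq_le_one_iff_abs_le_one]
    exact (Finset.single_le_sum (f := fun j => b j ^ 2) (fun j _ => sq_nonneg _) hj).trans hb
  obtain ⟨h1, h2⟩ := hΨ.integral_smooth_sum_le hα hconv hsq hF hFm hD hDi hD0 hDΨ hD1' s hb'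
  have hSm : AEStronglyMeasurable (fun ω => ∑ j ∈ s, b j * D j ω) μ :=
    Finset.aestronglyMeasurable_fun_sum s fun j _ =>
      ((hD j).mono (hFm j)).aestronglyMeasurable.const_mul _
  have hM := one_le_martConst hα
  have h3 : ∫ ω, Ψ |∑ j ∈ s, b j * D j ω| ∂μ ≤ martConst α := by
    calc _ ≤ ∫ ω, 2 ^ α * smooth Ψ (∑ j ∈ s, b j * D j ω) ∂μ :=
          integral_mono h1 ((hΨ.integrable_smooth hsq hSm h1).const_mul _)
            fun ω => hΨ.le_smooth hsq _
      _ = 2 ^ α * ∫ ω, smooth Ψ (∑ j ∈ s, b j * D j ω) ∂μ := integral_const_mul _ _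
      _ ≤ 2 ^ α * Real.exp (2 ^ α * 2 ^ α * 2 ^ α * ∑ j ∈ s, b j ^ 2) := by gcongr; linarith
      _ ≤ martConst α := by
          unfold martConst
          exact mul_le_mul_of_nonneg_left (Real.exp_le_exp.2
            (mul_le_of_le_one_right (by positivity) hb)) (by positivity)
  calc ∫⁻ ω, ENNReal.ofReal (Ψ (|∑ j ∈ s, b j * D j ω| / martConst α)) ∂μ
      ≤ ∫⁻ ω, ENNReal.ofReal (Ψ |∑ j ∈ s, b j * D j ω| * (martConst α)⁻¹) ∂μ := by
        refine lintegral_mono fun ω => ENNReal.ofReal_le_ofReal ?_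
        -- Since Ψ(0) = 0 and the constant is at least 1, convexity gives Ψ(x/M) ≤ Ψ(x)/M, which
        -- brings the modular bound M down to 1.
        have h := hconv.2 (abs_nonneg (∑ j ∈ s, b j * D j ω)) (le_refl (0 : ℝ))
          (show 0 ≤ (martConst α)⁻¹ by positivity)
          (sub_nonneg.2 (inv_le_one_of_one_le₀ hM)) (by ring)
        simpa [hΨ.map_zero, div_eq_inv_mul, mul_comm] using h
    _ = ENNReal.ofReal (∫ ω, Ψ |∑ j ∈ s, b j * D j ω| * (martConst α)⁻¹ ∂μ) :=
        (ofReal_integral_eq_lintegral_ofReal (h1.mul_const _) (ae_of_all _ fun ω =>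
          mul_nonneg (hnn _) (by positivity))).symm
    _ ≤ 1 := by
        rw [ENNReal.ofReal_le_one, integral_mul_const, ← div_eq_mul_inv,
          div_le_one (martConst_pos α)]
        exact h3

/-- Weighted sums of martingale differences satisfy a type 2 inequality in the Orlicz norm. -/
theorem ClassA.orliczNorm_sum_le [IsProbabilityMeasure μ] (hΨ : ClassA α Ψ) (hα : 0 < α)
    (hconv : ConvexOn ℝ (Set.Ici 0) Ψ)
    (hsq : ConvexOn ℝ (Set.Ici 0) (fun x => Ψ (Real.sqrt x))) {F : ℤ → MeasurableSpace Ω}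
    (hF : Monotone F) (hFm : ∀ j, F j ≤ mΩ) {D : ℤ → Ω → ℝ}
    (hD : ∀ j, StronglyMeasurable[F j] (D j)) (hDi : ∀ j, Integrable (D j) μ)
    (hD0 : ∀ j, μ[D j | F (j - 1)] =ᵐ[μ] 0) {p : ENNReal}
    (hDp : ∀ j, orliczNorm μ Ψ (D j) ≤ p) (b : ℤ → ℝ) (s : Finset ℤ) {B : ℝ} (hB : 0 ≤ B)
    (hb : ∑ j ∈ s, b j ^ 2 ≤ B ^ 2) :
    orliczNorm μ Ψ (fun ω => ∑ j ∈ s, b j * D j ω) ≤ ENNReal.ofReal (martConst α * B) * p := by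
  rcases hB.eq_or_lt with rfl | hB
  · have hb0 : ∀ j ∈ s, b j = 0 := fun j hj => by
      have := (Finset.single_le_sum (f := fun j => b j ^ 2) (fun j _ => sq_nonneg _) hj).trans hb
      simpa using this
    have : (fun ω => ∑ j ∈ s, b j * D j ω) = 0 := by
      ext ω
      exact Finset.sum_eq_zero fun j hj => by rw [hb0 j hj, zero_mul]
    rw [this, hΨ.orliczNorm_zero]
    exact bot_le
  have hM := martConst_pos α
  refine ENNReal.le_of_forall_ofReal_lt fun c hc hlt => ?_
  -- Homogeneity: dividing the weights by B and the differences by c' reduces to unit weights and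
  -- modulars at most 1; `c` exceeds the claimed bound exactly when c' exceeds p.
  set c' := c / (martConst α * B) with hc'
  have hc0 : 0 < c' := by positivity
  have hp' : p < ENNReal.ofReal c' := by
    have e : ENNReal.ofReal c = ENNReal.ofReal (martConst α * B) * ENNReal.ofReal c' := by
      rw [← ENNReal.ofReal_mul (by positivity), hc']
      congr 1; field_simp
    rw [e] at hlt
    exact lt_of_mul_lt_mul_left' hlt
  have h := hΨ.lintegral_sum_le_one hα hconv hsq hF hFm (D := fun j ω => D j ω * c'⁻¹)
    (fun j => (hD j).mul_const _) (fun j => (hDi j).mul_const _) (fun j => ?_)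
    (fun j => ?_) (b := fun j => b j / B) s ?_
  · refine orliczNorm_le_of_lintegral_le hc (le_trans (le_of_eq ?_) h)
    refine lintegral_congr fun ω => ?_
    have e : ∑ j ∈ s, b j / B * (D j ω * c'⁻¹) = (∑ j ∈ s, b j * D j ω) / (B * c') := by
      rw [Finset.sum_div]
      exact Finset.sum_congr rfl fun j _ => by field_simp
    rw [e, abs_div, abs_of_pos (mul_pos hB hc0), div_div]
    congr 3
    rw [hc']; field_simp
  · have h1 : (fun ω => D j ω * c'⁻¹) = c'⁻¹ • D j := by ext ω; simp [mul_comm]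
    rw [h1]
    filter_upwards [condExp_smul (μ := μ) c'⁻¹ (D j) (F (j - 1)), hD0 j] with ω h2 h3
    rw [h2]; simp [h3]
  · have := hΨ.lintegral_le_one_of_lt hc0 ((hDp j).trans_lt hp')
    simpa [abs_mul, abs_of_pos hc0, div_eq_mul_inv] using this
  · simp only [div_pow]
    rw [← Finset.sum_div, div_le_one (by positivity)]
    exact hb

end MartingaleType

/-! ### Iterates of the transformation and the stationary filtration -/

section Filtration

variable {Ω : Type*} {T : Equiv.Perm Ω} {F₀ : MeasurableSpace Ω}

theorem iter_zero (T : Equiv.Perm Ω) : iter T 0 = id := by simp [iter]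

theorem iter_add (T : Equiv.Perm Ω) (i j : ℤ) : iter T (i + j) = iter T i ∘ iter T j := by
  simp [iter, zpow_add]

theorem iter_one (T : Equiv.Perm Ω) : iter T 1 = T := by simp [iter]

theorem iter_neg_one (T : Equiv.Perm Ω) : iter T (-1) = T.symm := by simp [iter]

theorem statFiltration_comap (T : Equiv.Perm Ω) (F₀ : MeasurableSpace Ω) (i j : ℤ) :
    (statFiltration T F₀ i).comap (iter T j) = statFiltration T F₀ (i + j) := by
  rw [statFiltration, statFiltration, MeasurableSpace.comap_comp, iter_add]

theorem statFiltration_monotone (h : F₀ ≤ F₀.comap T) : Monotone (statFiltration T F₀) := by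
  refine monotone_int_of_le_succ fun i => ?_
  rw [statFiltration, add_comm, ← statFiltration_comap, statFiltration, iter_one]
  exact MeasurableSpace.comap_mono h

theorem statSeq_add (T : Equiv.Perm Ω) (ξ : Ω → ℝ) (k j : ℤ) :
    statSeq T ξ (k + j) = statSeq T ξ k ∘ iter T j := by
  rw [statSeq, iter_add]; rfl

theorem statSeq_zero (T : Equiv.Perm Ω) (ξ : Ω → ℝ) : statSeq T ξ 0 = ξ := by
  rw [statSeq, iter_zero]; rfl

variable [mΩ : MeasurableSpace Ω] {μ : Measure Ω}

theorem measurePreserving_iter (hT : MeasurePreserving T μ μ) (hT' : Measurable T.symm) (i : ℤ) :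
    MeasurePreserving (iter T i) μ μ := by
  have hs : MeasurePreserving T.symm μ μ :=
    MeasurePreserving.symm (⟨T, hT.measurable, hT'⟩ : Ω ≃ᵐ Ω) hT
  induction i using Int.induction_on with
  | zero => rw [iter_zero]; exact MeasurePreserving.id μ
  | succ i ih => rw [iter_add, iter_one]; exact ih.comp hT
  | pred i ih => rw [sub_eq_add_neg, iter_add, iter_neg_one]; exact ih.comp hs

theorem measurableEmbedding_iter (hT : MeasurePreserving T μ μ) (hT' : Measurable T.symm) (i : ℤ) :
    MeasurableEmbedding (iter T i) := by
  have h : (T ^ i).symm = T ^ (-i) := by rw [zpow_neg]; rfl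
  refine MeasurableEquiv.measurableEmbedding (⟨T ^ i, (measurePreserving_iter hT hT' i).measurable,
    ?_⟩ : Ω ≃ᵐ Ω)
  rw [h]
  exact (measurePreserving_iter hT hT' (-i)).measurable

theorem statFiltration_le (hT : MeasurePreserving T μ μ) (hT' : Measurable T.symm) (hF₀ : F₀ ≤ mΩ)
    (i : ℤ) : statFiltration T F₀ i ≤ mΩ :=
  (MeasurableSpace.comap_mono hF₀).trans (measurePreserving_iter hT hT' i).measurable.comap_le

end Filtration

/-! ### Conditional expectation under a measure-preserving map -/

section CondExp

variable {Ω : Type*} {m mΩ : MeasurableSpace Ω} {μ : Measure Ω} [IsProbabilityMeasure μ]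

theorem condExp_comp_measurePreserving {φ : Ω → Ω} (hφ : MeasurePreserving φ μ μ)
    (hφe : MeasurableEmbedding φ) (hm : m ≤ mΩ) {f : Ω → ℝ} (hf : Integrable f μ) :
    μ[f ∘ φ | m.comap φ] =ᵐ[μ] μ[f | m] ∘ φ := by
  have hm' : m.comap φ ≤ mΩ := (MeasurableSpace.comap_mono hm).trans hφ.measurable.comap_le
  have hmeas : StronglyMeasurable[m.comap φ] (μ[f | m] ∘ φ) :=
    (stronglyMeasurable_condExp (m := m)).comp_measurable (comap_measurable φ)
  refine (ae_eq_condExp_of_forall_setIntegral_eq hm' ?_ ?_ ?_ hmeas.aestronglyMeasurable).symm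
  · exact (hφ.integrable_comp_emb hφe).2 hf
  · exact fun s _ _ => ((hφ.integrable_comp_emb hφe).2 integrable_condExp).integrableOn
  · rintro s ⟨t, ht, rfl⟩ -
    have h1 := hφ.setIntegral_preimage_emb hφe (μ[f | m]) t
    have h2 := hφ.setIntegral_preimage_emb hφe f t
    simp only [Function.comp_apply]
    rw [h1, h2, setIntegral_condExp hm hf ht]

end CondExp

/-! ### The projections as stationary martingale differences -/

section Proj

variable {Ω : Type*} {T : Equiv.Perm Ω} {F₀ : MeasurableSpace Ω} [mΩ : MeasurableSpace Ω]
  {μ : Measure Ω}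

theorem proj_comp_iter [IsProbabilityMeasure μ] (hT : MeasurePreserving T μ μ) (hT' : Measurable T.symm) (hF₀ : F₀ ≤ mΩ)
    {Z : Ω → ℝ} (hZ : Integrable Z μ) (i j : ℤ) :
    proj F₀ μ T (i + j) (Z ∘ iter T j) =ᵐ[μ] proj F₀ μ T i Z ∘ iter T j := by
  have h : ∀ k, μ[Z ∘ iter T j | statFiltration T F₀ (k + j)] =ᵐ[μ]
      μ[Z | statFiltration T F₀ k] ∘ iter T j := fun k => by
    rw [← statFiltration_comap]
    exact condExp_comp_measurePreserving (measurePreserving_iter hT hT' j)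
      (measurableEmbedding_iter hT hT' j) (statFiltration_le hT hT' hF₀ k) hZ
  have e : i + j - 1 = i - 1 + j := by ring
  rw [proj, proj, e]
  filter_upwards [h i, h (i - 1)] with ω h1 h2
  simp [h1, h2]

theorem integrable_proj (j : ℤ) (Z : Ω → ℝ) : Integrable (proj F₀ μ T j Z) μ :=
  integrable_condExp.sub integrable_condExp

theorem stronglyMeasurable_proj (hF₀T : F₀ ≤ F₀.comap T) (j : ℤ) (Z : Ω → ℝ) :
    StronglyMeasurable[statFiltration T F₀ j] (proj F₀ μ T j Z) :=
  StronglyMeasurable.sub stronglyMeasurable_condExp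
    ((stronglyMeasurable_condExp (m := statFiltration T F₀ (j - 1))).mono
      (statFiltration_monotone hF₀T (by omega)))

theorem condExp_proj [IsProbabilityMeasure μ] (hT : MeasurePreserving T μ μ) (hT' : Measurable T.symm) (hF₀ : F₀ ≤ mΩ)
    (hF₀T : F₀ ≤ F₀.comap T) (j : ℤ) (Z : Ω → ℝ) :
    μ[proj F₀ μ T j Z | statFiltration T F₀ (j - 1)] =ᵐ[μ] 0 := by
  have hle := statFiltration_le hT hT' hF₀
  have h1 := condExp_sub (μ := μ) (f := μ[Z | statFiltration T F₀ j])
    (g := μ[Z | statFiltration T F₀ (j - 1)]) integrable_condExp integrable_condExp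
    (statFiltration T F₀ (j - 1))
  have h2 := condExp_condExp_of_le (μ := μ) (f := Z)
    (statFiltration_monotone hF₀T (show j - 1 ≤ j by omega)) (hle j)
  have h3 := condExp_of_stronglyMeasurable (μ := μ) (hle (j - 1))
    (stronglyMeasurable_condExp (f := Z) (μ := μ)) integrable_condExp
  rw [proj]
  filter_upwards [h1, h2] with ω h1 h2
  rw [h1, Pi.sub_apply, h2, h3]
  simp

theorem memLp_proj {Z : Ω → ℝ} (hZ : MemLp Z 2 μ) (j : ℤ) : MemLp (proj F₀ μ T j Z) 2 μ :=
  (hZ.condExp one_le_two).sub (hZ.condExp one_le_two)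

end Proj

/-! ### Recovering a regular variable from its projections -/

section Regular

/-- A limsup ignores finitely many terms, so it is measurable for every G M. -/
theorem limsup_measurable_iInf {Ω : Type*} {G : ℕ → MeasurableSpace Ω} (hG : Antitone G) {u : ℕ → Ω → ℝ}
    (hu : ∀ n, Measurable[G n] (u n)) :
    Measurable[⨅ n, G n] fun ω => limsup (fun n => u n ω) atTop := by
  have h : ∀ M, Measurable[G M] fun ω => limsup (fun n => u n ω) atTop := fun M => by
    have e : (fun ω => limsup (fun n => u n ω) atTop) =
        fun ω => limsup (fun n => u (n + M) ω) atTop := by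
      ext ω; exact (limsup_nat_add (fun n => u n ω) M).symm
    rw [e]
    exact @Measurable.limsup _ _ _ _ _ (G M) _ _ _ _ fun n => (hu (n + M)).mono (hG (by omega)) le_rfl
  intro s hs
  rw [MeasurableSpace.measurableSet_iInf]
  exact fun M => h M hs

/-- Upward convergence gives E(ξ|F_n) → ξ, so ξ - Z is an almost sure limit of E(ξ|F_{-n}) along a
subsequence. It is therefore measurable for the remote past, up to a null set, and equals its own
conditional expectation there. Regularity makes that conditional expectation zero, so no downward
martingale theorem is needed. -/
theorem ae_eq_of_tendsto_condExp_sub {Ω : Type*} {m mΩ : MeasurableSpace Ω} {μ : Measure Ω}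
    [IsProbabilityMeasure μ] {F : ℤ → MeasurableSpace Ω} (hF : Monotone F)
    (hFm : ∀ i, F i ≤ mΩ) {ξ Z : Ω → ℝ} (hξ : Integrable ξ μ) (hξm : StronglyMeasurable[⨆ i, F i] ξ)
    (hm_eq : m = ⨅ n : ℕ, F (-(n : ℤ))) (hreg : μ[ξ | m] =ᵐ[μ] 0) (hZ : MemLp Z 2 μ)
    (h : Tendsto (fun n : ℕ => eLpNorm (μ[ξ | F n] - μ[ξ | F (-(n : ℤ))] - Z) 2 μ) atTop (𝓝 0)) :
    Z =ᵐ[μ] ξ := by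
  let ℱ : MeasureTheory.Filtration ℕ mΩ :=
    ⟨fun n => F n, fun a b hab => hF (by exact_mod_cast hab), fun n => hFm n⟩
  have hsup : (⨆ i, F i) ≤ ⨆ n, ℱ n := iSup_le fun i =>
    (hF (Int.self_le_toNat i)).trans (le_iSup (fun n => ℱ n) i.toNat)
  have hup1 := hξ.tendsto_ae_condExp (ℱ := ℱ) (hξm.mono hsup)
  have hup2 := hξ.tendsto_eLpNorm_condExp (ℱ := ℱ) (hξm.mono hsup)
  change ∀ᵐ x ∂μ, Tendsto (fun n : ℕ => (μ[ξ | F n]) x) atTop (𝓝 (ξ x)) at hup1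
  change Tendsto (fun n : ℕ => eLpNorm (μ[ξ | F n] - ξ) 1 μ) atTop (𝓝 0) at hup2
  have hmF : ∀ n : ℕ, m ≤ F (-(n : ℤ)) := fun n => hm_eq ▸ iInf_le (fun n : ℕ => F (-(n : ℤ))) n
  have hm : m ≤ mΩ := (hmF 0).trans (hFm _)
  have hZi : Integrable Z μ := hZ.integrable one_le_two
  have hmeas : ∀ i, AEStronglyMeasurable (μ[ξ | F i]) μ := fun i =>
    (integrable_condExp (m := F i) (f := ξ) (μ := μ)).aestronglyMeasurable
  obtain ⟨ns, hns, hae⟩ := (tendstoInMeasure_of_tendsto_eLpNorm two_ne_zero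
    (fun n => (hmeas _).sub (hmeas _)) hZ.aestronglyMeasurable h).exists_seq_tendsto_ae
  set W : Ω → ℝ := ξ - Z with hW
  have hWi : Integrable W μ := hξ.sub hZi
  set W' : Ω → ℝ := fun ω => limsup (fun k => (μ[ξ | F (-(ns k : ℤ))]) ω) atTop with hW'
  have hWW' : W =ᵐ[μ] W' := by
    filter_upwards [hup1, hae] with ω h1 h2
    have h3 := (h1.comp hns.tendsto_atTop).sub h2
    refine (Tendsto.limsup_eq (h3.congr fun k => ?_)).symm
    simp
  have hW'm : Measurable[m] W' := by
    have h1 := limsup_measurable_iInf (G := fun k => F (-(ns k : ℤ)))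
      (fun a b hab => hF (by have := hns.monotone hab; simpa using this))
      (u := fun k => μ[ξ | F (-(ns k : ℤ))]) fun k => stronglyMeasurable_condExp.measurable
    refine h1.mono (hm_eq ▸ le_iInf fun n => (iInf_le _ n).trans (hF ?_)) le_rfl
    have := hns.id_le n
    simp only [id_eq] at this
    omega
  have hc1 : μ[W | m] =ᵐ[μ] W' := (condExp_congr_ae hWW').trans
    (EventuallyEq.of_eq (condExp_of_stronglyMeasurable hm hW'm.stronglyMeasurable (hWi.congr hWW')))
  have hc2 : eLpNorm (μ[W | m]) 1 μ = 0 := by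
    -- Subtracting E(ξ|F_{-n}) from W leaves E(W|m) unchanged, since E(ξ|m) = 0; conditional
    -- expectation then contracts L¹.
    have hle : ∀ n : ℕ, eLpNorm (μ[W | m]) 1 μ ≤ eLpNorm (μ[ξ | F n] - ξ) 1 μ +
        eLpNorm (μ[ξ | F n] - μ[ξ | F (-(n : ℤ))] - Z) 2 μ := fun n => by
      have h1 := condExp_sub (μ := μ) hWi (integrable_condExp (f := ξ) (m := F (-(n : ℤ)))) m
      have h2 := condExp_condExp_of_le (μ := μ) (f := ξ)
        (hmF n) (hFm _)
      have h3 : μ[W | m] =ᵐ[μ] μ[W - μ[ξ | F (-(n : ℤ))] | m] := by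
        filter_upwards [h1, h2, hreg] with ω h1 h2 h3
        rw [h1, Pi.sub_apply, h2, h3]; simp
      have h4 : W - μ[ξ | F (-(n : ℤ))] =
          (μ[ξ | F n] - μ[ξ | F (-(n : ℤ))] - Z) - (μ[ξ | F n] - ξ) := by
        rw [hW]; abel
      calc eLpNorm (μ[W | m]) 1 μ = eLpNorm (μ[W - μ[ξ | F (-(n : ℤ))] | m]) 1 μ :=
            eLpNorm_congr_ae h3
        _ ≤ eLpNorm (W - μ[ξ | F (-(n : ℤ))]) 1 μ := eLpNorm_condExp_le_eLpNorm _ le_rfl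
        _ ≤ eLpNorm (μ[ξ | F n] - μ[ξ | F (-(n : ℤ))] - Z) 1 μ + eLpNorm (μ[ξ | F n] - ξ) 1 μ := by
            rw [h4]
            exact eLpNorm_sub_le (((hmeas _).sub (hmeas _)).sub hZ.aestronglyMeasurable)
              ((hmeas _).sub hξ.aestronglyMeasurable) le_rfl
        _ ≤ _ := by
            rw [add_comm]
            gcongr
            exact eLpNorm_le_eLpNorm_of_exponent_le one_le_two
              (((hmeas _).sub (hmeas _)).sub hZ.aestronglyMeasurable)
    have hlim := hup2.add h
    rw [add_zero] at hlim
    exact le_antisymm (ge_of_tendsto' hlim hle) bot_le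
  rw [eLpNorm_eq_zero_iff integrable_condExp.aestronglyMeasurable one_ne_zero] at hc2
  filter_upwards [hc2, hc1, hWW'] with ω h1 h2 h3
  have : W ω = 0 := by rw [h3, ← h2, h1]; rfl
  simp only [hW, Pi.sub_apply] at this
  linarith

theorem sum_Ioc_neg_sub {E : Type*} [AddCommGroup E] (f : ℤ → E) (n : ℕ) :
    ∑ j ∈ Finset.Ioc (-(n : ℤ)) n, (f j - f (j - 1)) = f n - f (-(n : ℤ)) := by
  induction n with
  | zero => simp
  | succ n ih =>
    have e : Finset.Ioc (-((n + 1 : ℕ) : ℤ)) ((n + 1 : ℕ) : ℤ) =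
        insert ((n : ℤ) + 1) (insert (-(n : ℤ)) (Finset.Ioc (-(n : ℤ)) n)) := by
      ext x; simp only [Finset.mem_Ioc, Finset.mem_insert]; omega
    rw [e, Finset.sum_insert (by simp only [Finset.mem_insert, Finset.mem_Ioc]; omega),
      Finset.sum_insert (by simp), ih]
    push_cast
    rw [show (n : ℤ) + 1 - 1 = n by ring, show -(n : ℤ) - 1 = -(n + 1) by ring]
    abel

theorem tendsto_Ioc_neg_atTop :
    Tendsto (fun n : ℕ => Finset.Ioc (-(n : ℤ)) n) atTop atTop := by
  refine tendsto_atTop_finset_of_monotone (fun a b hab => ?_) fun x => ⟨x.natAbs + 1, ?_⟩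
  · intro x; simp only [Finset.mem_Ioc]; omega
  · simp only [Finset.mem_Ioc]; omega

end Regular

/-! ### Operators on ℓ² built from orthogonal increments -/

section Hilbert

variable {H : Type*} [NormedAddCommGroup H] [InnerProductSpace ℝ H]

/-- Normalised, the vectors are orthonormal and define an isometry of ℓ²; rescale by q. The operator
norm bound lets such operators be summed over k. -/
theorem exists_clm_hasSum_of_orthogonal [CompleteSpace H] {D : ℤ → H} {q : ℝ}
    (hD : Pairwise fun i j => inner ℝ (D i) (D j) = 0) (hq : ∀ j, ‖D j‖ = q) :
    ∃ E : lp (fun _ : ℤ => ℝ) 2 →L[ℝ] H, ‖E‖ ≤ q ∧ ∀ b, HasSum (fun j => b j • D j) (E b) := by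
  rcases eq_or_ne q 0 with h0 | h0
  · refine ⟨0, by simp [h0], fun b => ?_⟩
    have : ∀ j, D j = 0 := fun j => by rw [← norm_eq_zero, hq, h0]
    simp [this, hasSum_zero]
  have hq0 : 0 ≤ q := hq 0 ▸ norm_nonneg _
  have hv : Orthonormal ℝ fun j => q⁻¹ • D j := by
    refine ⟨fun j => ?_, fun i j hij => ?_⟩
    · rw [norm_smul, hq, norm_inv, Real.norm_of_nonneg hq0, inv_mul_cancel₀ h0]
    · have h : inner ℝ (D i) (D j) = 0 := hD hij
      simp [inner_smul_left, inner_smul_right, h]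
  refine ⟨q • hv.orthogonalFamily.linearIsometry.toContinuousLinearMap, ?_, fun b => ?_⟩
  · rw [norm_smul, Real.norm_of_nonneg hq0]
    exact mul_le_of_le_one_right hq0 (LinearIsometry.norm_toContinuousLinearMap_le _)
  · have h := (hv.orthogonalFamily.hasSum_linearIsometry b).const_smul q
    refine h.congr_fun fun j => ?_
    simp only [LinearIsometry.toSpanSingleton_apply]
    rw [smul_comm, smul_smul q, mul_inv_cancel₀ h0, one_smul]

theorem ContinuousLinearMap.hasSum_lp_single (A : lp (fun _ : ℤ => ℝ) 2 →L[ℝ] H)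
    (b : lp (fun _ : ℤ => ℝ) 2) : HasSum (fun i => b i • A (lp.single 2 i (1 : ℝ))) (A b) := by
  have h := A.hasSum (lp.hasSum_single ENNReal.ofNat_ne_top b)
  refine h.congr_fun fun i => ?_
  rw [← map_smul, ← lp.single_smul, smul_eq_mul, mul_one]

/-- The operators `c ↦ ∑_i c_i ξ_i` and `c ↦ ∑_i c_i d_i` attached to a family of orthogonal
increments, with the decomposition of their difference. -/
theorem exists_clm_pair [CompleteSpace H] {D : ℤ → ℤ → H} {q : ℤ → ℝ}
    (hD : ∀ k, Pairwise fun i j => inner ℝ (D k i) (D k j) = 0) (hq : ∀ k j, ‖D k j‖ = q k)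
    (hs : Summable q) :
    ∃ A A' : lp (fun _ : ℤ => ℝ) 2 →L[ℝ] H,
      (∀ i, HasSum (fun k => D k (i - k)) (A (lp.single 2 i (1 : ℝ)))) ∧
      (∀ i, HasSum (fun k => D k i) (A' (lp.single 2 i (1 : ℝ)))) ∧
      ∀ c : lp (fun _ : ℤ => ℝ) 2, ∃ Z : ℤ → H, HasSum Z (A c - A' c) ∧
        ∀ k, HasSum (fun j => (c (j + k) - c j) • D k j) (Z k) := by
  choose E hE hEs using fun k => exists_clm_hasSum_of_orthogonal (hD k) (hq k)
  -- The shift by k pairs coefficient j with D k (j - k), the k-th component of ξ_j.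
  choose B hB hBs using fun k => exists_clm_hasSum_of_orthogonal (D := fun j => D k (j - k))
    (fun i j hij => hD k (show i - k ≠ j - k by omega)) (fun j => hq k (j - k))
  have hEsum : Summable E := Summable.of_norm_bounded hs hE
  have hBsum : Summable B := Summable.of_norm_bounded hs hB
  have happ : ∀ (A : ℤ → lp (fun _ : ℤ => ℝ) 2 →L[ℝ] H), Summable A → ∀ c,
      HasSum (fun k => A k c) ((∑' k, A k) c) := fun A hA c =>
    hA.hasSum.mapL (ContinuousLinearMap.apply ℝ H c)
  have hsingle : ∀ (v : ℤ → H) (i : ℤ) (y : H),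
      HasSum (fun j => lp.single (E := fun _ : ℤ => ℝ) 2 i (1 : ℝ) j • v j) y → y = v i :=
    fun v i y h => by
      refine h.unique ?_
      convert hasSum_single i fun j hj => ?_ using 1
      · rw [lp.single_apply_self, one_smul]
      · rw [lp.single_apply_ne _ _ _ hj, zero_smul]
  refine ⟨∑' k, B k, ∑' k, E k, fun i => ?_, fun i => ?_, fun c => ⟨fun k => B k c - E k c,
    (happ B hBsum c).sub (happ E hEsum c), fun k => ?_⟩⟩
  · exact (happ B hBsum _).congr_fun fun k => (hsingle _ _ _ (hBs k _)).symm
  · exact (happ E hEsum _).congr_fun fun k => (hsingle _ _ _ (hEs k _)).symm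
  -- Reindexing j as j + k puts both series over the same D k j, so their coefficients subtract.
  · have h1 := (Equiv.addRight k).hasSum_iff.2 (hBs k c)
    refine (h1.sub (hEs k c)).congr_fun fun j => ?_
    simp [sub_smul]

end Hilbert

/-! ### Unconditional L² sums of random variables -/

section L2Sum

variable {Ω : Type*} [MeasurableSpace Ω] {μ : Measure Ω}

theorem hasL2Sum_of_hasSum {f : ℤ → Ω → ℝ} {X : ℤ → Lp ℝ 2 μ} {Y : Lp ℝ 2 μ}
    (hf : ∀ i, f i =ᵐ[μ] X i) (h : HasSum X Y) : HasL2Sum μ f Y := by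
  refine ⟨fun i => (memLp_congr_ae (hf i)).2 (Lp.memLp _), Lp.memLp _, ?_⟩
  refine ((Lp.tendsto_Lp_iff_tendsto_eLpNorm' _ _).1 h).congr fun s => eLpNorm_congr_ae ?_
  have h1 : ∀ s : Finset ℤ, (∑ i ∈ s, X i : Lp ℝ 2 μ) =ᵐ[μ] ∑ i ∈ s, f i := fun s => by
    induction s using Finset.induction_on with
    | empty => simpa using Lp.coeFn_zero ℝ 2 μ
    | insert i s hi ih =>
      rw [Finset.sum_insert hi, Finset.sum_insert hi]
      exact (Lp.coeFn_add _ _).trans ((hf i).symm.add ih)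
  exact (h1 s).sub (ae_eq_refl _)

theorem HasL2Sum.ae_eq {f : ℤ → Ω → ℝ} {g g' : Ω → ℝ} (h : HasL2Sum μ f g)
    (h' : HasL2Sum μ f g') : g =ᵐ[μ] g' := by
  have hlim := h'.2.2.add h.2.2
  rw [add_zero] at hlim
  have hle : ∀ s : Finset ℤ, eLpNorm (g - g') 2 μ ≤
      eLpNorm (∑ i ∈ s, f i - g') 2 μ + eLpNorm (∑ i ∈ s, f i - g) 2 μ := fun s => by
    have hs : AEStronglyMeasurable (∑ i ∈ s, f i) μ :=
      Finset.aestronglyMeasurable_sum s fun i _ => (h.1 i).1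
    have e : g - g' = (∑ i ∈ s, f i - g') - (∑ i ∈ s, f i - g) := by abel
    rw [e]
    exact eLpNorm_sub_le (hs.sub h'.2.1.1) (hs.sub h.2.1.1) one_le_two
  have h0 : eLpNorm (g - g') 2 μ = 0 := le_antisymm (ge_of_tendsto' hlim hle) bot_le
  rw [eLpNorm_eq_zero_iff (h.2.1.1.sub h'.2.1.1) two_ne_zero] at h0
  filter_upwards [h0] with ω hω
  simpa [sub_eq_zero] using hω

theorem HasL2Sum.l2Sum {f : ℤ → Ω → ℝ} {g : Ω → ℝ} (h : HasL2Sum μ f g) :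
    HasL2Sum μ f (l2Sum μ f) := by
  have h' : ∃ g, HasL2Sum μ f g := ⟨g, h⟩
  rw [_root_.l2Sum, dif_pos h']
  exact h'.choose_spec

end L2Sum

/-! ### Shift increments of the coefficients and lower bounds for v_n -/

section Coefficients

theorem memℓp_two_of_summable {b : ℤ → ℝ} (hb : Summable fun i => b i ^ 2) :
    Memℓp (E := fun _ : ℤ => ℝ) b 2 := by
  rw [memℓp_gen_iff (by simp)]
  simpa using hb

theorem lp_two_norm_sq (b : lp (fun _ : ℤ => ℝ) 2) : HasSum (fun i => b i ^ 2) (‖b‖ ^ 2) := by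
  have := lp.hasSum_norm (by simp) b
  simpa using this

theorem summable_sq_shift {a : ℤ → ℝ} (ha : Summable fun i => a i ^ 2) (k : ℤ) :
    Summable fun i => a (k - i) ^ 2 :=
  ha.comp_injective (Equiv.subLeft k).injective

/-- The square summable sequence `i ↦ a (k - i)`. -/
noncomputable def revShift {a : ℤ → ℝ} (ha : Summable fun i => a i ^ 2) (k : ℤ) :
    lp (fun _ : ℤ => ℝ) 2 :=
  ⟨fun i => a (k - i), memℓp_two_of_summable (summable_sq_shift ha k)⟩

/-- The coefficients `c_{n,j}` as an element of `ℓ²`. -/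
noncomputable def coefLp {a : ℤ → ℝ} (ha : Summable fun i => a i ^ 2) (n : ℕ) :
    lp (fun _ : ℤ => ℝ) 2 :=
  ∑ k ∈ Finset.Icc 1 n, revShift ha k

theorem coefLp_apply {a : ℤ → ℝ} (ha : Summable fun i => a i ^ 2) (n : ℕ) (j : ℤ) :
    coefLp ha n j = coefSum a n j := by
  rw [coefLp, lp.coeFn_sum, Finset.sum_apply, coefSum]
  rfl

theorem norm_coefLp_sq {a : ℤ → ℝ} (ha : Summable fun i => a i ^ 2) (n : ℕ) :
    ‖coefLp ha n‖ ^ 2 = vSq a n := by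
  rw [← (lp_two_norm_sq (coefLp ha n)).tsum_eq, vSq]
  simp only [coefLp_apply]

theorem norm_coefLp {a : ℤ → ℝ} (ha : Summable fun i => a i ^ 2) (n : ℕ) :
    ‖coefLp ha n‖ = Real.sqrt (vSq a n) := by
  rw [← norm_coefLp_sq ha, Real.sqrt_sq (norm_nonneg _)]

theorem norm_revShift {a : ℤ → ℝ} (ha : Summable fun i => a i ^ 2) (k : ℤ) :
    ‖revShift ha k‖ = ‖revShift ha 0‖ := by
  rw [← sq_eq_sq₀ (norm_nonneg _) (norm_nonneg _), ← (lp_two_norm_sq (revShift ha k)).tsum_eq,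
    ← (lp_two_norm_sq (revShift ha 0)).tsum_eq]
  change ∑' i, a (k - i) ^ 2 = ∑' i, a (0 - i) ^ 2
  have h := (Equiv.subRight k).tsum_eq fun i => a (0 - i) ^ 2
  rw [← h]
  refine tsum_congr fun i => ?_
  simp

theorem coefSum_sub_succ (a : ℤ → ℝ) (n : ℕ) (j : ℤ) :
    coefSum a n j - coefSum a n (j + 1) = a (n - j) - a (-j) := by
  induction n with
  | zero => simp [coefSum]
  | succ n ih =>
    have e : ∀ j, coefSum a (n + 1) j = coefSum a n j + a ((n + 1 : ℕ) - j) := fun j => by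
      rw [coefSum, Finset.sum_Icc_succ_top (by omega)]; rfl
    rw [e, e]
    have e2 : ((n + 1 : ℕ) : ℤ) - (j + 1) = n - j := by push_cast; ring
    rw [e2]
    linarith

/-- The shift of a square summable sequence. -/
noncomputable def shiftLp (c : lp (fun _ : ℤ => ℝ) 2) (k : ℤ) : lp (fun _ : ℤ => ℝ) 2 :=
  ⟨fun j => c (j + k), memℓp_two_of_summable
    ((lp_two_norm_sq c).summable.comp_injective (Equiv.addRight k).injective)⟩

theorem shiftLp_apply (c : lp (fun _ : ℤ => ℝ) 2) (k j : ℤ) : shiftLp c k j = c (j + k) := rfl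

theorem shiftLp_zero (c : lp (fun _ : ℤ => ℝ) 2) : shiftLp c 0 = c := by
  ext j; simp [shiftLp_apply]

theorem shiftLp_shiftLp (c : lp (fun _ : ℤ => ℝ) 2) (k l : ℤ) :
    shiftLp (shiftLp c k) l = shiftLp c (k + l) := by
  ext j; rw [shiftLp_apply, shiftLp_apply, shiftLp_apply, add_assoc, add_comm l]

theorem shiftLp_sub (c d : lp (fun _ : ℤ => ℝ) 2) (k : ℤ) :
    shiftLp (c - d) k = shiftLp c k - shiftLp d k := by
  ext j; rfl

theorem norm_shiftLp (c : lp (fun _ : ℤ => ℝ) 2) (k : ℤ) : ‖shiftLp c k‖ = ‖c‖ := by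
  rw [← sq_eq_sq₀ (norm_nonneg _) (norm_nonneg _), ← (lp_two_norm_sq (shiftLp c k)).tsum_eq,
    ← (lp_two_norm_sq c).tsum_eq]
  exact (Equiv.addRight k).tsum_eq fun i => c i ^ 2

theorem norm_shiftLp_sub_le_two (c : lp (fun _ : ℤ => ℝ) 2) (k : ℤ) :
    ‖shiftLp c k - c‖ ≤ 2 * ‖c‖ := by
  have := norm_sub_le (shiftLp c k) c
  rw [norm_shiftLp] at this
  linarith

/-- Move by |k| unit shifts and use the triangle inequality; shifts are isometries, which also
reduces negative k to positive k. -/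
theorem norm_shiftLp_sub_le (c : lp (fun _ : ℤ => ℝ) 2) (k : ℤ) :
    ‖shiftLp c k - c‖ ≤ |(k : ℝ)| * ‖shiftLp c 1 - c‖ := by
  have key : ∀ n : ℕ, ‖shiftLp c n - c‖ ≤ n * ‖shiftLp c 1 - c‖ := fun n => by
    induction n with
    | zero => simp [shiftLp_zero]
    | succ n ih =>
      have e : shiftLp c ((n + 1 : ℕ) : ℤ) - c = shiftLp (shiftLp c 1 - c) n + (shiftLp c n - c) := by
        rw [shiftLp_sub, shiftLp_shiftLp]; push_cast; rw [add_comm 1]; abel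
      rw [e]
      refine (norm_add_le _ _).trans ?_
      rw [norm_shiftLp]
      push_cast
      linarith
  rcases Int.eq_nat_or_neg k with ⟨n, rfl | rfl⟩
  · simpa using key n
  · have e : shiftLp c (-n) - c = -shiftLp (shiftLp c n - c) (-n) := by
      rw [shiftLp_sub, shiftLp_shiftLp]; simp [shiftLp_zero]
    rw [e, norm_neg, norm_shiftLp]
    simpa using key n

/-- The one-step increment of c_n telescopes to a(-j) - a(n-j), so the bound does not depend on n.
This is the source of the term C₂m. -/
theorem norm_shiftLp_coefLp_sub_le {a : ℤ → ℝ} (ha : Summable fun i => a i ^ 2) (n : ℕ) :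
    ‖shiftLp (coefLp ha n) 1 - coefLp ha n‖ ≤ 2 * ‖revShift ha 0‖ := by
  have e : shiftLp (coefLp ha n) 1 - coefLp ha n = revShift ha 0 - revShift ha n := by
    ext j
    have h := coefSum_sub_succ a n j
    have h1 : shiftLp (coefLp ha n) 1 j = coefSum a n (j + 1) := by
      rw [shiftLp_apply, coefLp_apply]
    have h2 : (revShift ha 0) j = a (-j) := by change a (0 - j) = _; simp
    have h3 : (revShift ha n) j = a (n - j) := rfl
    rw [lp.coeFn_sub, lp.coeFn_sub, Pi.sub_apply, Pi.sub_apply, h1, coefLp_apply, h2, h3]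
    linarith
  rw [e]
  refine (norm_sub_le _ _).trans ?_
  rw [norm_revShift ha n]
  linarith

theorem abs_coefSum_le {a : ℤ → ℝ} (ha : Summable fun i => a i ^ 2) (n : ℕ) (j : ℤ) :
    |coefSum a n j| ≤ Real.sqrt (vSq a n) := by
  rw [← norm_coefLp ha, ← coefLp_apply ha]
  exact lp.norm_apply_le_norm two_ne_zero (coefLp ha n) j

/-- The norms `v_n`, `n ≥ 1`, are bounded away from zero unless `a = 0`. -/
theorem exists_le_sqrt_vSq {a : ℤ → ℝ} (ha : Summable fun i => a i ^ 2) {i₀ : ℤ} (h0 : a i₀ ≠ 0) :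
    ∃ κ : ℝ, 0 < κ ∧ ∀ n : ℕ, 1 ≤ n → κ ≤ Real.sqrt (vSq a n) := by
  have hlim : Tendsto (fun n : ℕ => a (i₀ + n)) atTop (𝓝 0) := by
    have h1 : Tendsto (fun n : ℕ => a (i₀ + n) ^ 2) atTop (𝓝 0) :=
      (ha.comp_injective (i := fun n : ℕ => i₀ + n) fun x y h => by
        simpa using h).tendsto_atTop_zero
    have h2 := h1.sqrt
    simp only [Real.sqrt_sq_eq_abs, Real.sqrt_zero] at h2
    exact (tendsto_zero_iff_abs_tendsto_zero _).2 h2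
  have hpos : 0 < |a i₀| / 2 := by positivity
  obtain ⟨N, hN⟩ := (Metric.tendsto_atTop.1 hlim) _ hpos
  -- Each step of length n changes a by at most 2v_n. After N + 1 such steps from i₀ the value has
  -- dropped below |a i₀|/2, so 2(N+1)v_n is at least |a i₀|/2.
  refine ⟨|a i₀| / 2 / (2 * (N + 1)), by positivity, fun n hn => ?_⟩
  have hstep : ∀ i, |a (i + n) - a i| ≤ 2 * Real.sqrt (vSq a n) := fun i => by
    have h := coefSum_sub_succ a n (-i)
    rw [sub_neg_eq_add, neg_neg, add_comm (n : ℤ)] at h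
    rw [← h]
    have h1 := abs_coefSum_le ha n (-i)
    have h2 := abs_coefSum_le ha n (-i + 1)
    exact (abs_sub _ _).trans (by linarith)
  have hmul : ∀ r : ℕ, |a (i₀ + (r * n : ℕ)) - a i₀| ≤ r * (2 * Real.sqrt (vSq a n)) := fun r => by
    induction r with
    | zero => simp
    | succ r ih =>
      have h := hstep (i₀ + (r * n : ℕ))
      have e : i₀ + ((r + 1) * n : ℕ) = i₀ + (r * n : ℕ) + n := by push_cast; ring
      rw [e]
      have := abs_sub_le (a (i₀ + (r * n : ℕ) + n)) (a (i₀ + (r * n : ℕ))) (a i₀)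
      push_cast at *
      linarith
  have h1 := hN ((N + 1) * n) (by nlinarith)
  have h2 := hmul (N + 1)
  rw [Real.dist_0_eq_abs] at h1
  have h3 := abs_sub_abs_le_abs_sub (a i₀) (a (i₀ + ((N + 1) * n : ℕ)))
  rw [abs_sub_comm] at h3
  rw [div_le_iff₀ (by positivity)]
  push_cast at *
  linarith

/-- If v_n ≥ κ then v_n ≤ v_n²/κ; the cases n = 0 and a = 0 are trivial. This turns the v_n estimate
into the v_n² one. -/
theorem exists_sqrt_vSq_le {a : ℤ → ℝ} (ha : Summable fun i => a i ^ 2) :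
    ∃ L : ℝ, 0 ≤ L ∧ ∀ n : ℕ, Real.sqrt (vSq a n) ≤ L * vSq a n := by
  have hv : ∀ n, 0 ≤ vSq a n := fun n => tsum_nonneg fun _ => sq_nonneg _
  by_cases h : ∃ i, a i ≠ 0
  · obtain ⟨i, hi⟩ := h
    obtain ⟨κ, hκ, hle⟩ := exists_le_sqrt_vSq ha hi
    refine ⟨κ⁻¹, by positivity, fun n => ?_⟩
    rcases Nat.eq_zero_or_pos n with rfl | hn
    · simp [vSq, coefSum]
    · rw [← div_eq_inv_mul, le_div_iff₀ hκ]
      calc _ ≤ Real.sqrt (vSq a n) * Real.sqrt (vSq a n) :=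
            mul_le_mul_of_nonneg_left (hle n hn) (Real.sqrt_nonneg _)
        _ = _ := Real.mul_self_sqrt (hv n)
  · push Not at h
    exact ⟨0, le_rfl, fun n => by simp [vSq, coefSum, h]⟩

end Coefficients

/-! ### The increments P_j(ξ_{j+k}) in L² and in the Ψ-norm -/

section Increments

/-- The martingale difference `P_j(ξ_{j+k})` as an element of `L²`. -/
noncomputable def incr {Ω : Type*} (F₀ : MeasurableSpace Ω) [MeasurableSpace Ω] {μ : Measure Ω}
    {T : Equiv.Perm Ω} {ξ₀ : Ω → ℝ} (h : ∀ i, MemLp (statSeq T ξ₀ i) 2 μ) (k j : ℤ) : Lp ℝ 2 μ :=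
  (memLp_proj (F₀ := F₀) (T := T) (h (j + k)) j).toLp _

variable {Ω : Type*} {T : Equiv.Perm Ω} {F₀ : MeasurableSpace Ω} [mΩ : MeasurableSpace Ω]
  {μ : Measure Ω} {ξ₀ : Ω → ℝ}

theorem memLp_statSeq (hT : MeasurePreserving T μ μ) (hT' : Measurable T.symm) (hξ : MemLp ξ₀ 2 μ)
    (i : ℤ) : MemLp (statSeq T ξ₀ i) 2 μ :=
  hξ.comp_measurePreserving (measurePreserving_iter hT hT' i)

theorem coeFn_incr (h : ∀ i, MemLp (statSeq T ξ₀ i) 2 μ) (k j : ℤ) :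
    incr F₀ h k j =ᵐ[μ] proj F₀ μ T j (statSeq T ξ₀ (j + k)) :=
  MemLp.coeFn_toLp _

variable [IsProbabilityMeasure μ]

theorem proj_statSeq_add (hT : MeasurePreserving T μ μ) (hT' : Measurable T.symm) (hF₀ : F₀ ≤ mΩ)
    (h : ∀ i, MemLp (statSeq T ξ₀ i) 2 μ) (k i j : ℤ) :
    proj F₀ μ T (i + j) (statSeq T ξ₀ (i + j + k)) =ᵐ[μ]
      proj F₀ μ T i (statSeq T ξ₀ (i + k)) ∘ iter T j := by
  have e : i + j + k = i + k + j := by ring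
  rw [e, statSeq_add T ξ₀ (i + k) j]
  exact proj_comp_iter hT hT' hF₀ ((h (i + k)).integrable one_le_two) i j

theorem incr_add (hT : MeasurePreserving T μ μ) (hT' : Measurable T.symm) (hF₀ : F₀ ≤ mΩ)
    (h : ∀ i, MemLp (statSeq T ξ₀ i) 2 μ) (k i j : ℤ) :
    incr F₀ h k (i + j) =
      Lp.compMeasurePreserving (iter T j) (measurePreserving_iter hT hT' j) (incr F₀ h k i) := by
  rw [incr, incr, Lp.toLp_compMeasurePreserving, MemLp.toLp_eq_toLp_iff]
  exact proj_statSeq_add hT hT' hF₀ h k i j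

theorem norm_incr (hT : MeasurePreserving T μ μ) (hT' : Measurable T.symm) (hF₀ : F₀ ≤ mΩ)
    (h : ∀ i, MemLp (statSeq T ξ₀ i) 2 μ) (k j : ℤ) :
    ‖incr F₀ h k j‖ = ‖incr F₀ h k 0‖ := by
  have e := incr_add hT hT' hF₀ h k 0 j
  rw [zero_add] at e
  rw [e, Lp.norm_compMeasurePreserving]

theorem orliczNorm_proj (hT : MeasurePreserving T μ μ) (hT' : Measurable T.symm) (hF₀ : F₀ ≤ mΩ)
    (h : ∀ i, MemLp (statSeq T ξ₀ i) 2 μ) (Ψ : ℝ → ℝ) (k j : ℤ) :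
    orliczNorm μ Ψ (proj F₀ μ T j (statSeq T ξ₀ (j + k))) =
      orliczNorm μ Ψ (proj F₀ μ T 0 (statSeq T ξ₀ k)) := by
  have e := proj_statSeq_add hT hT' hF₀ h k 0 j
  rw [zero_add, zero_add] at e
  rw [orliczNorm_congr_ae e, orliczNorm_comp (measurePreserving_iter hT hT' j)
    (measurableEmbedding_iter hT hT' j)]

theorem integral_mul_eq_zero_of_condExp_eq_zero {Ω : Type*} {m mΩ : MeasurableSpace Ω}
    {μ : Measure Ω} [IsProbabilityMeasure μ] (hm : m ≤ mΩ) {X Y : Ω → ℝ}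
    (hXm : StronglyMeasurable[m] X) (hX : MemLp X 2 μ) (hY : MemLp Y 2 μ)
    (h0 : μ[Y | m] =ᵐ[μ] 0) : ∫ ω, X ω * Y ω ∂μ = 0 := by
  have h1 := condExp_mul_of_stronglyMeasurable_left hXm (hX.integrable_mul hY)
    (hY.integrable one_le_two)
  have h2 := integral_condExp hm (f := X * Y) (μ := μ)
  rw [integral_congr_ae h1] at h2
  simp only [Pi.mul_apply] at h2
  rw [← h2]
  refine integral_eq_zero_of_ae ?_
  filter_upwards [h0] with ω hω
  simp [hω]

theorem inner_incr (hT : MeasurePreserving T μ μ) (hT' : Measurable T.symm) (hF₀ : F₀ ≤ mΩ)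
    (hF₀T : F₀ ≤ F₀.comap T) (h : ∀ i, MemLp (statSeq T ξ₀ i) 2 μ) (k : ℤ) :
    Pairwise fun i j => inner ℝ (incr F₀ h k i) (incr F₀ h k j) = 0 := by
  have key : ∀ i j, i < j → inner ℝ (incr F₀ h k j) (incr F₀ h k i) = 0 := fun i j hij => by
    rw [L2.inner_def]
    have h1 := integral_mul_eq_zero_of_condExp_eq_zero (statFiltration_le hT hT' hF₀ (j - 1))
      ((stronglyMeasurable_proj (μ := μ) hF₀T i (statSeq T ξ₀ (i + k))).mono
        (statFiltration_monotone hF₀T (show i ≤ j - 1 by omega)))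
      (memLp_proj (h (i + k)) i) (memLp_proj (F₀ := F₀) (T := T) (h (j + k)) j)
      (condExp_proj hT hT' hF₀ hF₀T j _)
    rw [← h1]
    refine integral_congr_ae ?_
    filter_upwards [coeFn_incr (F₀ := F₀) h k i, coeFn_incr (F₀ := F₀) h k j] with ω h2 h3
    rw [h2, h3]
    simp
  intro i j hij
  rcases lt_or_gt_of_ne hij with hlt | hlt
  · rw [real_inner_comm]
    exact key i j hlt
  · exact key j i hlt

/-- A weighted sum of the increments `P_j(ξ_{j+k})`, `j ∈ ℤ`, in the Orlicz norm. -/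
theorem ClassA.orliczNorm_le_of_hasSum_incr {α : ℝ} {Ψ : ℝ → ℝ} (hΨ : ClassA α Ψ) (hα : 0 < α)
    (hconv : ConvexOn ℝ (Set.Ici 0) Ψ)
    (hsq : ConvexOn ℝ (Set.Ici 0) (fun x => Ψ (Real.sqrt x)))
    (hT : MeasurePreserving T μ μ) (hT' : Measurable T.symm) (hF₀ : F₀ ≤ mΩ)
    (hF₀T : F₀ ≤ F₀.comap T) (h : ∀ i, MemLp (statSeq T ξ₀ i) 2 μ) (k : ℤ)
    (b : lp (fun _ : ℤ => ℝ) 2) {Z : Lp ℝ 2 μ}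
    (hZ : HasSum (fun j => b j • incr F₀ h k j) Z) :
    orliczNorm μ Ψ Z ≤ ENNReal.ofReal (martConst α * ‖b‖) *
      orliczNorm μ Ψ (proj F₀ μ T 0 (statSeq T ξ₀ k)) := by
  refine hΨ.orliczNorm_Lp_le_of_tendsto hZ fun s => ?_
  have e : (∑ j ∈ s, b j • incr F₀ h k j : Lp ℝ 2 μ) =ᵐ[μ]
      fun ω => ∑ j ∈ s, b j * proj F₀ μ T j (statSeq T ξ₀ (j + k)) ω := by
    induction s using Finset.induction_on with
    | empty => exact Lp.coeFn_zero ℝ 2 μ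
    | insert i s hi ih =>
      rw [Finset.sum_insert hi]
      filter_upwards [Lp.coeFn_add (b i • incr F₀ h k i) (∑ j ∈ s, b j • incr F₀ h k j), ih,
        Lp.coeFn_smul (b i) (incr F₀ h k i), coeFn_incr (F₀ := F₀) h k i] with ω h1 h2 h3 h4
      rw [h1, Pi.add_apply, h2, h3, Pi.smul_apply, h4, Finset.sum_insert hi, smul_eq_mul]
  rw [orliczNorm_congr_ae e]
  exact hΨ.orliczNorm_sum_le hα hconv hsq (statFiltration_monotone hF₀T)
    (statFiltration_le hT hT' hF₀) (fun j => stronglyMeasurable_proj hF₀T j _)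
    (fun j => integrable_proj j _) (fun j => condExp_proj hT hT' hF₀ hF₀T j _)
    (fun j => (orliczNorm_proj hT hT' hF₀ h Ψ k j).le) b s (norm_nonneg b)
    (sum_le_hasSum s (fun _ _ => sq_nonneg _) (lp_two_norm_sq b))

/-- A square summable regular variable is the sum of its projections. -/
theorem hasSum_incr_eq (hT : MeasurePreserving T μ μ) (hT' : Measurable T.symm) (hF₀ : F₀ ≤ mΩ)
    (hF₀T : F₀ ≤ F₀.comap T) (h : ∀ i, MemLp (statSeq T ξ₀ i) 2 μ)
    (hξmeas : Measurable[totalField T F₀] ξ₀) (hξreg : μ[ξ₀ | pastField T F₀] =ᵐ[μ] 0)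
    (hs : Summable fun k => incr F₀ h k (0 - k)) (i : ℤ) :
    HasSum (fun k => incr F₀ h k (i - k)) ((h i).toLp _) := by
  obtain ⟨Z, hZ⟩ := hs
  have hξ : MemLp ξ₀ 2 μ := by simpa only [statSeq_zero] using h 0
  have hZξ : Z =ᵐ[μ] ξ₀ := by
    -- With k = -j, the increment at time 0 - k is P_j(ξ_0), so the symmetric partial sums telescope
    -- to E(ξ_0|F_n) - E(ξ_0|F_{-n}).
    have h1 := (Equiv.neg ℤ).hasSum_iff.2 hZ
    have h2 : HasL2Sum μ (fun j => proj F₀ μ T j ξ₀) Z := by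
      refine hasL2Sum_of_hasSum (fun j => ?_) h1
      have e := coeFn_incr (F₀ := F₀) h (-j) (0 - -j)
      have e1 : 0 - -j = j := by ring
      simp only [e1, add_neg_cancel, statSeq_zero] at e
      simp only [Function.comp_apply, Equiv.neg_apply, e1]
      exact e.symm
    refine ae_eq_of_tendsto_condExp_sub (statFiltration_monotone hF₀T)
      (statFiltration_le hT hT' hF₀) (hξ.integrable one_le_two) hξmeas.stronglyMeasurable rfl hξreg
      h2.2.1 ((h2.2.2.comp tendsto_Ioc_neg_atTop).congr fun n => ?_)
    rw [Function.comp_apply, ← sum_Ioc_neg_sub (fun j => μ[ξ₀ | statFiltration T F₀ j])]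
    rfl
  -- Composition with T^i is an isometry of L² and carries the expansion of ξ_0 to that of ξ_i.
  have h3 := hZ.mapL (Lp.compMeasurePreservingₗᵢ ℝ (iter T i)
    (measurePreserving_iter hT hT' i)).toContinuousLinearMap
  have e : (h i).toLp _ = Lp.compMeasurePreserving (iter T i) (measurePreserving_iter hT hT' i) Z := by
    have e1 : Z = hξ.toLp ξ₀ := by
      rw [← Lp.toLp_coeFn Z (Lp.memLp Z), MemLp.toLp_eq_toLp_iff]; exact hZξ
    rw [e1, Lp.toLp_compMeasurePreserving]
    rfl
  rw [e]
  refine h3.congr_fun fun k => ?_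
  rw [show i - k = 0 - k + i by ring, incr_add hT hT' hF₀ h k (0 - k) i]
  rfl

end Increments

/-! ### Linear processes as images of their coefficient sequences -/

section LinearProcess

variable {Ω : Type*} [MeasurableSpace Ω] {μ : Measure Ω}

theorem hasL2Sum_linTerm (A : lp (fun _ : ℤ => ℝ) 2 →L[ℝ] Lp ℝ 2 μ) {u : ℤ → Ω → ℝ}
    (hu : ∀ i, u i =ᵐ[μ] A (lp.single 2 i (1 : ℝ))) {a : ℤ → ℝ} (ha : Summable fun i => a i ^ 2)
    (k : ℤ) : HasL2Sum μ (linTerm a u k) (A (revShift ha k)) := by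
  have h1 := (Equiv.subLeft k).hasSum_iff.2 (A.hasSum_lp_single (revShift ha k))
  refine hasL2Sum_of_hasSum (fun j => ?_) h1
  have e : (revShift ha k) (k - j) = a j := by
    change a (k - (k - j)) = a j; rw [sub_sub_cancel]
  simp only [Function.comp_apply, Equiv.subLeft_apply, e]
  filter_upwards [hu (k - j), Lp.coeFn_smul (a j) (A (lp.single 2 (k - j) (1 : ℝ)))] with ω h2 h3
  rw [h3, linTerm, Pi.smul_apply, Pi.smul_apply, h2]

theorem linPartialSum_ae_eq (A : lp (fun _ : ℤ => ℝ) 2 →L[ℝ] Lp ℝ 2 μ) {u : ℤ → Ω → ℝ}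
    (hu : ∀ i, u i =ᵐ[μ] A (lp.single 2 i (1 : ℝ))) {a : ℤ → ℝ} (ha : Summable fun i => a i ^ 2)
    (n : ℕ) : linPartialSum μ a u n =ᵐ[μ] A (coefLp ha n) := by
  rw [linPartialSum, coefLp, map_sum]
  generalize Finset.Icc 1 n = s
  induction s using Finset.induction_on with
  | empty => simpa using (Lp.coeFn_zero ℝ 2 μ).symm
  | insert i s hi ih =>
    rw [Finset.sum_insert hi, Finset.sum_insert hi]
    have h := hasL2Sum_linTerm A hu ha i
    exact ((h.l2Sum.ae_eq h).add ih).trans (Lp.coeFn_add _ _).symm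

end LinearProcess

/-! ### Splitting at |k| = m and the final estimate -/

theorem ENNReal.tsum_le_tsum_subtype_add {p : ℤ → ENNReal} {w : ℤ → ℝ} {V W m : ℝ} (hm : 0 ≤ m)
    (hV : ∀ k, w k ≤ V) (hW0 : 0 ≤ W) (hW : ∀ k, w k ≤ |(k : ℝ)| * W) (hp : ∑' k, p k ≠ ⊤) :
    ∑' k, ENNReal.ofReal (w k) * p k ≤
      ENNReal.ofReal V * (∑' k : {k : ℤ // m ≤ |(k : ℝ)|}, p k) +
        ENNReal.ofReal (W * (∑' k, p k).toReal * m) := by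
  -- The uniform bound V is used where |k| ≥ m, and |k|W ≤ mW elsewhere.
  have hle : ∀ k, ENNReal.ofReal (w k) * p k ≤
      ENNReal.ofReal V * {k : ℤ | m ≤ |(k : ℝ)|}.indicator p k + ENNReal.ofReal (m * W) * p k := by
    intro k
    by_cases hk : m ≤ |(k : ℝ)|
    · rw [Set.indicator_of_mem (show k ∈ {k : ℤ | m ≤ |(k : ℝ)|} from hk)]
      refine le_add_right ?_
      gcongr
      exact hV k
    · refine le_add_left ?_
      gcongr
      exact (hW k).trans (mul_le_mul_of_nonneg_right (not_le.1 hk).le hW0)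
  have hsub : ∑' k : {k : ℤ // m ≤ |(k : ℝ)|}, p k =
      ∑' k, {k : ℤ | m ≤ |(k : ℝ)|}.indicator p k := tsum_subtype {k : ℤ | m ≤ |(k : ℝ)|} p
  have hW' : ENNReal.ofReal (W * (∑' k, p k).toReal * m) = ENNReal.ofReal (m * W) * ∑' k, p k := by
    rw [show W * (∑' k, p k).toReal * m = m * W * (∑' k, p k).toReal by ring,
      ENNReal.ofReal_mul (by positivity), ENNReal.ofReal_toReal hp]
  rw [hsub, hW', ← ENNReal.tsum_mul_left, ← ENNReal.tsum_mul_left, ← ENNReal.tsum_add]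
  exact ENNReal.tsum_le_tsum hle

theorem mainTheorem11 {Ω : Type*} (F₀ : MeasurableSpace Ω) [mΩ : MeasurableSpace Ω]
    (μ : Measure Ω) [IsProbabilityMeasure μ]
    -- the bimeasurable bijection `T`, preserving the probability
    (T : Equiv.Perm Ω) (hT : MeasurePreserving T μ μ) (hT' : Measurable T.symm)
    -- the sub-σ-algebra `F₀` with `F₀ ⊆ T⁻¹ F₀`
    (hF₀ : F₀ ≤ mΩ) (hF₀T : F₀ ≤ F₀.comap T)
    -- the Young function `Ψ`
    (α : ℝ) (hα : 0 < α) (Ψ : ℝ → ℝ) (hΨ : ClassA α Ψ) (hΨne : ∃ x, 0 ≤ x ∧ Ψ x ≠ 0)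
    (hΨconv : ConvexOn ℝ (Set.Ici 0) Ψ)
    (hΨsqrt : ConvexOn ℝ (Set.Ici 0) (fun x => Ψ (Real.sqrt x)))
    -- the regular random variable `ξ₀`
    (ξ₀ : Ω → ℝ) (hξmeas : Measurable[totalField T F₀] ξ₀) (hξΨ : MemOrlicz μ Ψ ξ₀)
    (hξreg : μ[ξ₀ | pastField T F₀] =ᵐ[μ] 0)
    (hsum : ∑' j : ℤ, orliczNorm μ Ψ (proj F₀ μ T 0 (statSeq T ξ₀ j)) < ⊤)
    -- the coefficients
    (a : ℤ → ℝ) (ha : Summable (fun i => a i ^ 2)) :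
    -- the series which define `d_j`, `X_k` and `Y_k` converge in `L²`
    (∀ j : ℤ, HasL2Sum μ (fun l => proj F₀ μ T j (statSeq T ξ₀ l)) (mdiff F₀ μ T ξ₀ j)) ∧
    (∀ k : ℤ, HasL2Sum μ (linTerm a (statSeq T ξ₀) k) (linProc μ a (statSeq T ξ₀) k)) ∧
    (∀ k : ℤ, HasL2Sum μ (linTerm a (mdiff F₀ μ T ξ₀) k) (linProc μ a (mdiff F₀ μ T ξ₀) k)) ∧
    -- the approximation, with constants that depend neither on `n` nor on `m`
    ∃ C₁ C₂ : ℝ, 0 < C₁ ∧ 0 < C₂ ∧ ∀ (n : ℕ) (m : ℝ), 0 < m →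
      orliczNorm μ Ψ
          (linPartialSum μ a (statSeq T ξ₀) n - linPartialSum μ a (mdiff F₀ μ T ξ₀) n) ≤
        ENNReal.ofReal (C₁ * vSq a n) *
            (∑' k : {k : ℤ // m ≤ |(k : ℝ)|}, orliczNorm μ Ψ (proj F₀ μ T 0 (statSeq T ξ₀ k))) +
          ENNReal.ofReal (C₂ * m) ∧
      orliczNorm μ Ψ
          (linPartialSum μ a (statSeq T ξ₀) n - linPartialSum μ a (mdiff F₀ μ T ξ₀) n) ≤
        ENNReal.ofReal (C₁ * Real.sqrt (vSq a n)) *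
            (∑' k : {k : ℤ // m ≤ |(k : ℝ)|}, orliczNorm μ Ψ (proj F₀ μ T 0 (statSeq T ξ₀ k))) +
          ENNReal.ofReal (C₂ * m) := by
  have hξ2 : MemLp ξ₀ 2 μ := hΨ.memLp_two hΨne hΨsqrt hξΨ
  have h := fun i => memLp_statSeq hT hT' hξ2 i
  obtain ⟨K, hK, hle⟩ := hΨ.exists_eLpNorm_le (μ := μ) hΨne hΨsqrt
  have hsum' : Summable fun k => ‖incr F₀ h k 0‖ := by
    have h1 : ∑' k : ℤ, K * orliczNorm μ Ψ (proj F₀ μ T 0 (statSeq T ξ₀ k)) ≠ ⊤ := by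
      rw [ENNReal.tsum_mul_left]
      exact ENNReal.mul_ne_top hK hsum.ne
    refine Summable.of_nonneg_of_le (fun _ => norm_nonneg _) (fun k => ?_)
      (ENNReal.summable_toReal h1)
    rw [Lp.norm_def]
    refine ENNReal.toReal_mono (ENNReal.ne_top_of_tsum_ne_top h1 k) ?_
    rw [eLpNorm_congr_ae (coeFn_incr (F₀ := F₀) h k 0), zero_add]
    exact hle _
  obtain ⟨A, A', hA, hA', hAA'⟩ := exists_clm_pair (inner_incr hT hT' hF₀ hF₀T h)
    (norm_incr hT hT' hF₀ h) hsum'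
  have hAξ : ∀ i, statSeq T ξ₀ i =ᵐ[μ] A (lp.single 2 i (1 : ℝ)) := fun i => by
    rw [(hA i).unique (hasSum_incr_eq hT hT' hF₀ hF₀T h hξmeas hξreg (hA 0).summable i)]
    exact (MemLp.coeFn_toLp _).symm
  have hd : ∀ j, HasL2Sum μ (fun l => proj F₀ μ T j (statSeq T ξ₀ l))
      (A' (lp.single 2 j (1 : ℝ))) := fun j => by
    refine hasL2Sum_of_hasSum (fun l => ?_) ((Equiv.subRight j).hasSum_iff.2 (hA' j))
    have e := coeFn_incr (F₀ := F₀) h (l - j) j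
    rw [add_sub_cancel] at e
    exact e.symm
  have hAd : ∀ j, mdiff F₀ μ T ξ₀ j =ᵐ[μ] A' (lp.single 2 j (1 : ℝ)) := fun j =>
    (hd j).l2Sum.ae_eq (hd j)
  refine ⟨fun j => (hd j).l2Sum, fun k => (hasL2Sum_linTerm A hAξ ha k).l2Sum,
    fun k => (hasL2Sum_linTerm A' hAd ha k).l2Sum, ?_⟩
  set P := ∑' k : ℤ, orliczNorm μ Ψ (proj F₀ μ T 0 (statSeq T ξ₀ k)) with hP
  have hM := martConst_pos α
  obtain ⟨L, hL, hvL⟩ := exists_sqrt_vSq_le ha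
  have hmain : ∀ (n : ℕ) (m : ℝ), 0 < m → orliczNorm μ Ψ
      (linPartialSum μ a (statSeq T ξ₀) n - linPartialSum μ a (mdiff F₀ μ T ξ₀) n) ≤
      ENNReal.ofReal (martConst α * (2 * Real.sqrt (vSq a n))) *
        (∑' k : {k : ℤ // m ≤ |(k : ℝ)|}, orliczNorm μ Ψ (proj F₀ μ T 0 (statSeq T ξ₀ k))) +
      ENNReal.ofReal (martConst α * (2 * ‖revShift ha 0‖) * P.toReal * m) := by
    intro n m hm
    set c := coefLp ha n with hc
    obtain ⟨Z, hZ, hZk⟩ := hAA' c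
    have e : linPartialSum μ a (statSeq T ξ₀) n - linPartialSum μ a (mdiff F₀ μ T ξ₀) n =ᵐ[μ]
        (A c - A' c : Lp ℝ 2 μ) :=
      ((linPartialSum_ae_eq A hAξ ha n).sub (linPartialSum_ae_eq A' hAd ha n)).trans
        (Lp.coeFn_sub _ _).symm
    rw [orliczNorm_congr_ae e]
    -- The countable triangle inequality over the lag k, followed by the type 2 inequality at each
    -- lag.
    refine (hΨ.orliczNorm_Lp_le_of_hasSum hΨconv hZ).trans ?_
    refine (ENNReal.tsum_le_tsum fun k => hΨ.orliczNorm_le_of_hasSum_incr hα hΨconv hΨsqrt hT hT'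
      hF₀ hF₀T h k (shiftLp c k - c) (hZk k)).trans ?_
    refine ENNReal.tsum_le_tsum_subtype_add hm.le (fun k => ?_) (by positivity) (fun k => ?_) hsum.ne
    · rw [← norm_coefLp ha n]
      exact mul_le_mul_of_nonneg_left (norm_shiftLp_sub_le_two c k) hM.le
    · calc martConst α * ‖shiftLp c k - c‖
          ≤ martConst α * (|(k : ℝ)| * (2 * ‖revShift ha 0‖)) :=
            mul_le_mul_of_nonneg_left ((norm_shiftLp_sub_le c k).trans
              (mul_le_mul_of_nonneg_left (norm_shiftLp_coefLp_sub_le ha n) (abs_nonneg _))) hM.le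
        _ = _ := by ring
  have hC₂ : 0 ≤ martConst α * (2 * ‖revShift ha 0‖) * P.toReal := by positivity
  have hmono : ∀ (n : ℕ) (m V : ℝ), 0 < m → martConst α * (2 * Real.sqrt (vSq a n)) ≤ V →
      orliczNorm μ Ψ
        (linPartialSum μ a (statSeq T ξ₀) n - linPartialSum μ a (mdiff F₀ μ T ξ₀) n) ≤
      ENNReal.ofReal V *
        (∑' k : {k : ℤ // m ≤ |(k : ℝ)|}, orliczNorm μ Ψ (proj F₀ μ T 0 (statSeq T ξ₀ k))) +
      ENNReal.ofReal ((martConst α * (2 * ‖revShift ha 0‖) * P.toReal + 1) * m) := by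
    intro n m V hm hV
    refine (hmain n m hm).trans ?_
    gcongr
    linarith
  have hv : ∀ n, 0 ≤ vSq a n := fun n => tsum_nonneg fun _ => sq_nonneg _
  -- One C₁ serves both forms: the summand L covers v_n², the summand 1 covers v_n. The + 1 keeps C₂
  -- positive when a = 0 or all the projections vanish.
  refine ⟨2 * martConst α * (1 + L), martConst α * (2 * ‖revShift ha 0‖) * P.toReal + 1,
    by positivity, by positivity, fun n m hm => ⟨hmono n m _ hm ?_, hmono n m _ hm ?_⟩⟩
  · calc martConst α * (2 * Real.sqrt (vSq a n)) ≤ martConst α * (2 * (L * vSq a n)) := by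
          gcongr; exact hvL n
      _ ≤ martConst α * (2 * (L * vSq a n)) + 2 * martConst α * vSq a n :=
          le_add_of_nonneg_right (mul_nonneg (by positivity) (hv n))
      _ = _ := by ring
  · calc martConst α * (2 * Real.sqrt (vSq a n))
        ≤ martConst α * (2 * Real.sqrt (vSq a n)) + 2 * martConst α * L * Real.sqrt (vSq a n) :=
          le_add_of_nonneg_right (by positivity)
      _ = _ := by ring
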